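/- **Setting.** Let $(M,g)$ be a complete connected $n$-dimensional smooth Riemannian manifold without boundary, $n\ge 2$, with Riemannian distance $d_g$ and volume $\mathrm{vol}_g$, and let $\omega=e^{-f}\mathrm{vol}_g$ with $f\in C^\infty(M)$. Let $\varphi:(0,\infty)\to(0,\infty)$ be continuous and non-decreasing. Put $$\ln_\varphi(t)=\int_1^t\frac{ds}{\varphi(s)}\ (t>0),\quad l_\varphi=\inf_{t>0}\ln_\varphi(t),\quad L_\varphi=\sup_{t>0}\ln_\varphi(t),\quad u_\varphi(r)=\int_0^r\ln_\varphi(t)\,dt\ (r\ge0),$$ and let $\exp_\varphi:\mathbb R\to[0,\infty]$ be the inverse of $\ln_\varphi$ on $(l_\varphi,L_\varphi)$, equal to $0$ on $\{\tau\le l_\varphi\}$ and to $\infty$ on $\{\tau\ge L_\varphi\}$. Let $\theta_\varphi$ and $\delta_\varphi$ be the supremum and the infimum over $s>0$ of $$\frac{s}{\varphi(s)}\limsup_{t\downarrow0}\frac{\varphi(s+t)-\varphi(s)}{t}.$$ Put $h_\varphi(r)=u_\varphi(r)$ if $L_\varphi=\infty$ and $h_\varphi(r)=u_\varphi(r)-rL_\varphi$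 if $L_\varphi<\infty$; let $h_\varphi'(\infty)=\lim_{r\to\infty}h_\varphi'(r)$, which is $\infty$ if $L_\varphi=\infty$ and $0$ if $L_\varphi<\infty$. For continuous $\Psi:M\to\mathbb R$ put $\sigma=\exp_\varphi(-\Psi)$, $\nu=\sigma\omega$ and $M_\varphi^\Psi=\Psi^{-1}((-L_\varphi,-l_\varphi))$. The quadruple $(M,\omega,\varphi,\Psi)$ is *admissible* if $\varphi(1)=1$; $\theta_\varphi\le(n+1)/n$ and $\theta_\varphi<3/2$; $\Psi>-L_{\psi}$ on $M$, where $L_\psi$ is the supremum above for the power function $\psi(s)=s^{\theta_\varphi}$; $M_\varphi^\Psi\ne\emptyset$; and $h_\varphi(\sigma),\ \sigma\ln_\varphi(\sigma)\in L^1(M,\omega)$. For a Borel probability measure $\mu$ on $M$ with Lebesgue decomposition $\mu=\rho\omega+\mu^s$, the *$\varphi$-relative entropy* is $$H_\varphi(\mu)=\int_M h_\varphi(\rho)\,d\omega-\int_M h_\varphi'(\sigma)\,d\mu+h_\varphi'(\infty)\,\mu^s[M]$$ if $h_\varphi(\rho)\in L^1(M,\omega)$ and $h_\varphi'(\sigma)\in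 L^1(M,\mu)$, and $H_\varphi(\mu)=\infty$ otherwise; here $\infty\cdot0=0$, and on $M\setminus M_\varphi^\Psi$ one sets $h'_\varphi(\sigma)=l_\varphi$ if $L_\varphi=\infty$ and $h'_\varphi(\sigma)=l_\varphi-L_\varphi$ if $L_\varphi<\infty$. Let $\mathcal P^2(M)$ be the set of Borel probability measures on $M$ with finite second moment, with the $L^2$-Wasserstein distance $W_2$. We write $\mathrm{Hess}\,H_\varphi\ge K$ if $H_\varphi\not\equiv\infty$ on $\mathcal P^2(M)$ and any $\mu_0,\mu_1\in\mathcal P^2(M)$ are joined by a curve $(\mu_t)_{t\in[0,1]}$ in $\mathcal P^2(M)$ with $W_2(\mu_s,\mu_t)=|s-t|\,W_2(\mu_0,\mu_1)$ for all $s,t\in[0,1]$ and $$H_\varphi(\mu_t)\le(1-t)H_\varphi(\mu_0)+tH_\varphi(\mu_1)-\frac K2(1-t)t\,W_2(\mu_0,\mu_1)^2\qquad\text{for all }t\in[0,1].$$ For a Borel probability measure $\nu$ on $M$ and $r>0$ put $$\alpha_{(M,\nu)}(r)=\sup\{1-\nu[B(A,r)] : A\subset M\text{ measurable},\ \nu[A]\ge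 1/2\},\quad B(A,r)=\{y : \inf_{x\in A}d_g(x,y)<r\}.$$ **Theorem.** Let $(M,\omega,\varphi,\Psi_i)$, $i\in\mathbb N$, be a sequence of admissible spaces such that (a) $\omega[M]<\infty$ if $\theta_\varphi>1$; (b) $\nu_i=\sigma_i\omega:=\exp_\varphi(-\Psi_i)\,\omega$ is a probability measure for every $i$; (c) $\xi_i:=\max\{1,\|\sigma_i\|_{L^\infty(M,\omega)}\}<\infty$ for every $i$; (d) $\mathrm{Hess}\,H^i_\varphi\ge K_i$ for some $K_i>0$, for every $i$, where $H^i_\varphi$ is the $\varphi$-relative entropy of $(M,\omega,\varphi,\Psi_i)$; (e) $\lim_{i\to\infty}K_i\,\xi_i^{\delta_\varphi-1}=\infty$ if $\theta_\varphi\le1$, and $\lim_{i\to\infty}K_i\,\xi_i^{\delta_\varphi-\theta_\varphi}=\infty$ if $\theta_\varphi>1$. Then $\lim_{i\to\infty}\alpha_{(M,\nu_i)}(r)=0$ for every $r>0$. -/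

import Mathlib

open MeasureTheory Set Filter Topology Manifold Bundle
open scoped ENNReal ContDiff

noncomputable section

namespace PhiEntropy

/-! ### Riemannian volume -/

/-- The Gram determinant `det (g (∂ᵢ, ∂ⱼ))` of the coordinate frame of the preferred chart at `p`,
as a function of the coordinates `y`. -/
def gramDet (n : ℕ) {M : Type*} [TopologicalSpace M] [ChartedSpace (EuclideanSpace ℝ (Fin n)) M]
    [RiemannianBundle (fun x : M => TangentSpace (𝓡 n) x)]
    (p : M) (y : EuclideanSpace ℝ (Fin n)) : ℝ :=
  let c := (chartAt (EuclideanSpace ℝ (Fin n)) p).symm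
  let coordVec : Fin n → TangentSpace (𝓡 n) (c y) := fun i =>
    mfderiv (𝓡 n) (𝓡 n) c y (EuclideanSpace.single i (1 : ℝ))
  (Matrix.of fun i j : Fin n => inner ℝ (coordVec i) (coordVec j)).det

/-- The Riemannian volume inside the domain of the preferred chart at `p`: the image in `M` of
`√(det g) dy` on the coordinate domain. -/
def chartVolume (n : ℕ) {M : Type*} [TopologicalSpace M]
    [ChartedSpace (EuclideanSpace ℝ (Fin n)) M]
    [RiemannianBundle (fun x : M => TangentSpace (𝓡 n) x)] [MeasurableSpace M]
    (p : M) : Measure M :=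
  ((volume.restrict (chartAt (EuclideanSpace ℝ (Fin n)) p).target).withDensity
    (fun y => ENNReal.ofReal (Real.sqrt (gramDet n p y)))).map
      (chartAt (EuclideanSpace ℝ (Fin n)) p).symm

theorem exists_chart_cover (n : ℕ) (M : Type*) [TopologicalSpace M] [SecondCountableTopology M]
    [Nonempty M] [ChartedSpace (EuclideanSpace ℝ (Fin n)) M] :
    ∃ p : ℕ → M, ⋃ i, (chartAt (EuclideanSpace ℝ (Fin n)) (p i)).source = univ := by
  obtain ⟨s, hs, hU⟩ := TopologicalSpace.countable_cover_nhds
    (fun x : M => chart_source_mem_nhds (EuclideanSpace ℝ (Fin n)) x)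
  have hne : s.Nonempty := by
    obtain ⟨x⟩ := ‹Nonempty M›
    have hx : x ∈ ⋃ y ∈ s, (chartAt (EuclideanSpace ℝ (Fin n)) y).source := hU ▸ mem_univ x
    simp only [mem_iUnion] at hx
    obtain ⟨y, hy, -⟩ := hx
    exact ⟨y, hy⟩
  obtain ⟨p, rfl⟩ := hs.exists_eq_range hne
  exact ⟨p, by simpa using hU⟩

/-- A countable family of preferred charts covering `M`. -/
def coverPoint (n : ℕ) (M : Type*) [TopologicalSpace M] [SecondCountableTopology M]
    [Nonempty M] [ChartedSpace (EuclideanSpace ℝ (Fin n)) M] : ℕ → M :=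
  Classical.choose (exists_chart_cover n M)

/-- The Riemannian volume measure: `M` is cut into countably many disjoint Borel pieces, each inside
the domain of one chart, and `√(det g) dy` is used on each piece. By the change of variables formula
the measure depends neither on the charts nor on the pieces. -/
def riemannianVolume (n : ℕ) (M : Type*) [TopologicalSpace M] [SecondCountableTopology M]
    [Nonempty M] [ChartedSpace (EuclideanSpace ℝ (Fin n)) M]
    [RiemannianBundle (fun x : M => TangentSpace (𝓡 n) x)] [MeasurableSpace M] : Measure M :=
  Measure.sum fun i : ℕ =>
    (chartVolume n (coverPoint n M i)).restrict
      (disjointed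
        (fun j => (chartAt (EuclideanSpace ℝ (Fin n)) (coverPoint n M j)).source) i)

/-- The weighted volume `e^{-f} vol_g`. -/
def weightedVolume (n : ℕ) {M : Type*} [TopologicalSpace M] [SecondCountableTopology M]
    [Nonempty M] [ChartedSpace (EuclideanSpace ℝ (Fin n)) M]
    [RiemannianBundle (fun x : M => TangentSpace (𝓡 n) x)] [MeasurableSpace M]
    (f : M → ℝ) : Measure M :=
  (riemannianVolume n M).withDensity fun x => ENNReal.ofReal (Real.exp (-f x))

/-! ### `φ`-logarithm, `φ`-exponential and the orders of `φ` -/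

/-- `φ : (0, ∞) → (0, ∞)` is continuous and non-decreasing (values of `φ` outside `(0, ∞)` play no
role). -/
structure IsAdmissibleWeight (φ : ℝ → ℝ) : Prop where
  pos : ∀ s, 0 < s → 0 < φ s
  monotoneOn : MonotoneOn φ (Ioi 0)
  continuousOn : ContinuousOn φ (Ioi 0)

/-- `ln_φ t = ∫₁ᵗ ds / φ(s)`, for `t > 0`. -/
def lnPhi (φ : ℝ → ℝ) (t : ℝ) : ℝ := ∫ s in (1 : ℝ)..t, (φ s)⁻¹

/-- `l_φ = inf_{t > 0} ln_φ t`. -/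
def lowerLim (φ : ℝ → ℝ) : EReal := ⨅ t ∈ Ioi (0 : ℝ), (lnPhi φ t : EReal)

/-- `L_φ = sup_{t > 0} ln_φ t`. -/
def upperLim (φ : ℝ → ℝ) : EReal := ⨆ t ∈ Ioi (0 : ℝ), (lnPhi φ t : EReal)

open Classical in
/-- The `φ`-exponential: the inverse of `ln_φ` on `(l_φ, L_φ)`, extended by `0` below `l_φ` and by
`∞` above `L_φ`. -/
def expPhi (φ : ℝ → ℝ) (τ : ℝ) : ℝ≥0∞ :=
  if (τ : EReal) ≤ lowerLim φ then 0
  else if upperLim φ ≤ (τ : EReal) then ⊤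
  else ENNReal.ofReal (Function.invFunOn (lnPhi φ) (Ioi 0) τ)

/-- `u_φ(r) = ∫₀ʳ ln_φ t dt`. -/
def uPhi (φ : ℝ → ℝ) (r : ℝ) : ℝ := ∫ t in (0 : ℝ)..r, lnPhi φ t

/-- `(s / φ(s)) · limsup_{t ↓ 0} (φ(s + t) - φ(s)) / t`. -/
def localOrder (φ : ℝ → ℝ) (s : ℝ) : EReal :=
  ((s / φ s : ℝ) : EReal) *
    limsup (fun t : ℝ => (((φ (s + t) - φ s) / t : ℝ) : EReal)) (𝓝[>] 0)

/-- `θ_φ`. -/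
def theta (φ : ℝ → ℝ) : EReal := ⨆ s ∈ Ioi (0 : ℝ), localOrder φ s

/-- `δ_φ`. -/
def delta (φ : ℝ → ℝ) : EReal := ⨅ s ∈ Ioi (0 : ℝ), localOrder φ s

/-- The power weight `φ_m(s) = s^{2 - m}`. -/
def powerWeight (m : ℝ) (s : ℝ) : ℝ := s ^ (2 - m)

open Classical in
/-- `h_φ(r) = u_φ(r)` if `L_φ = ∞`, and `u_φ(r) - r L_φ` if `L_φ < ∞`. -/
def hPhi (φ : ℝ → ℝ) (r : ℝ) : ℝ :=
  if upperLim φ = ⊤ then uPhi φ r else uPhi φ r - r * (upperLim φ).toReal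

open Classical in
/-- `h'_φ(∞) = lim_{r → ∞} h'_φ(r)`. -/
def hPhiDerivAtTop (φ : ℝ → ℝ) : EReal := if upperLim φ = ⊤ then ⊤ else 0

/-! ### Admissible spaces and the `φ`-relative entropy -/

/-- The set `M_φ^Ψ = Ψ⁻¹((-L_φ, -l_φ))`. -/
def effectiveDomain {M : Type*} (φ : ℝ → ℝ) (Ψ : M → ℝ) : Set M :=
  {x | -upperLim φ < (Ψ x : EReal) ∧ (Ψ x : EReal) < -lowerLim φ}

/-- The reference density `σ = exp_φ(-Ψ)`. -/
def refDensity {M : Type*} (φ : ℝ → ℝ) (Ψ : M → ℝ) (x : M) : ℝ≥0∞ := expPhi φ (-Ψ x)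

/-- The reference measure `ν = exp_φ(-Ψ) ω₀`. -/
def refMeasure {M : Type*} [MeasurableSpace M] (ω₀ : Measure M) (φ : ℝ → ℝ) (Ψ : M → ℝ) :
    Measure M :=
  ω₀.withDensity (refDensity φ Ψ)

/-- Admissibility of the quadruple `(M, ω₀, φ, Ψ)`, where `n` is the dimension of `M`. -/
structure IsAdmissible {M : Type*} [TopologicalSpace M] [MeasurableSpace M] (n : ℕ)
    (ω₀ : Measure M) (φ : ℝ → ℝ) (Ψ : M → ℝ) : Prop where
  continuous : Continuous Ψ
  normalized : φ 1 = 1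
  theta_le : theta φ ≤ (((n + 1 : ℝ) / n : ℝ) : EReal)
  theta_lt : theta φ < ((3 / 2 : ℝ) : EReal)
  lt_potential : ∀ x, -upperLim (powerWeight (2 - (theta φ).toReal)) < (Ψ x : EReal)
  nonempty : (effectiveDomain φ Ψ).Nonempty
  integrable_h : Integrable (fun x => hPhi φ (refDensity φ Ψ x).toReal) ω₀
  integrable_mul_ln : Integrable
    (fun x => (refDensity φ Ψ x).toReal * lnPhi φ (refDensity φ Ψ x).toReal) ω₀

open Classical in
/-- The function `h'_φ(σ)` on `M`, where `h'_φ = ln_φ` if `L_φ = ∞` and `h'_φ = ln_φ - L_φ` if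
`L_φ < ∞`. Outside `M_φ^Ψ`, where `σ = 0`, the value of `ln_φ` is understood as `l_φ` (if
`l_φ = -∞` and `Ψ > -L_φ`, then `M_φ^Ψ` is all of `M`). -/
def hPhiDerivRef {M : Type*} (φ : ℝ → ℝ) (Ψ : M → ℝ) (x : M) : ℝ :=
  (if x ∈ effectiveDomain φ Ψ then lnPhi φ (refDensity φ Ψ x).toReal else (lowerLim φ).toReal)
    - (if upperLim φ = ⊤ then 0 else (upperLim φ).toReal)

open Classical in
/-- The `φ`-relative entropy
`H_φ(μ) = ∫ h_φ(ρ) dω₀ - ∫ h'_φ(σ) dμ + h'_φ(∞) μˢ(M)`, where `μ = ρ ω₀ + μˢ` is the Lebesgue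
decomposition of `μ` with respect to `ω₀`; it is `∞` if one of the two integrals fails to exist. -/
def relEntropy {M : Type*} [MeasurableSpace M] (ω₀ : Measure M) (φ : ℝ → ℝ) (Ψ : M → ℝ)
    (μ : Measure M) : EReal :=
  if Integrable (fun x => hPhi φ (μ.rnDeriv ω₀ x).toReal) ω₀ ∧ Integrable (hPhiDerivRef φ Ψ) μ then
    (((∫ x, hPhi φ (μ.rnDeriv ω₀ x).toReal ∂ω₀) - ∫ x, hPhiDerivRef φ Ψ x ∂μ : ℝ) : EReal)
      + hPhiDerivAtTop φ * ((μ.singularPart ω₀ univ : ℝ≥0∞) : EReal)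
  else ⊤

/-! ### Convexity along minimal geodesics and the Wasserstein space -/

/-- A minimal geodesic `γ : [0, 1] → X` from `x` to `y` with respect to the distance `d`. -/
def IsMinimalGeodesic {X : Type*} (d : X → X → ℝ) (γ : unitInterval → X) (x y : X) : Prop :=
  γ 0 = x ∧ γ 1 = y ∧ ∀ s t : unitInterval, d (γ s) (γ t) = |(s : ℝ) - t| * d x y

/-- `Hess F ≥ K`: the function `F : X → (-∞, ∞]`, not identically `∞`, is `K`-convex in the weak
sense on the space `X` with distance `d`. -/
def IsKConvex {X : Type*} (d : X → X → ℝ) (K : ℝ) (F : X → EReal) : Prop :=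
  (∃ x, F x ≠ ⊤) ∧
  ∀ x y, ∃ γ : unitInterval → X, IsMinimalGeodesic d γ x y ∧
    ∀ t : unitInterval,
      F (γ t) ≤ ((1 - (t : ℝ) : ℝ) : EReal) * F x + (((t : ℝ) : ℝ) : EReal) * F y
        - ((K / 2 * (1 - (t : ℝ)) * (t : ℝ) * d x y ^ 2 : ℝ) : EReal)

/-- `P²(M)`: the Borel probability measures on `M` with finite second moment. -/
def ProbTwo (M : Type*) [MetricSpace M] [MeasurableSpace M] : Type _ :=
  {μ : Measure M // IsProbabilityMeasure μ ∧ ∃ x₀ : M, ∫⁻ x, edist x₀ x ^ 2 ∂μ < ⊤}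

/-- `q` is a coupling of `μ` and `ν`. -/
def IsCoupling {M : Type*} [MeasurableSpace M] (q : Measure (M × M)) (μ ν : Measure M) : Prop :=
  q.map Prod.fst = μ ∧ q.map Prod.snd = ν

/-- The `L²`-Wasserstein distance on `P²(M)`. -/
def wassersteinDist {M : Type*} [MetricSpace M] [MeasurableSpace M] (μ ν : ProbTwo M) : ℝ :=
  ((⨅ (q : Measure (M × M)) (_ : IsCoupling q μ.1 ν.1),
    ∫⁻ z, edist z.1 z.2 ^ 2 ∂q) ^ (1 / 2 : ℝ)).toReal

/-! ### Concentration function -/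

/-- The concentration function
`α_{(M, ν)}(r) = sup {1 - ν(B(A, r)) | A measurable, ν(A) ≥ 1/2}`,
where `B(A, r)` is the open `r`-neighbourhood of `A`. -/
def concentration {M : Type*} [MetricSpace M] [MeasurableSpace M] (ν : Measure M) (r : ℝ) : ℝ≥0∞ :=
  ⨆ (A : Set M) (_ : MeasurableSet A) (_ : 1 / 2 ≤ ν A), 1 - ν (Metric.thickening r A)

/-- `max {1, ‖σ‖_∞}`, the norm being that of `L^∞(M, ω₀)`. -/
def densityBound {M : Type*} [MeasurableSpace M] (ω₀ : Measure M) (σ : M → ℝ≥0∞) : ℝ :=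
  max 1 (essSup σ ω₀).toReal

end PhiEntropy

end

open PhiEntropy

open MeasureTheory Set Filter Topology Manifold Bundle
open scoped ENNReal ContDiff

noncomputable section

namespace PhiEntropy

/-! ### Orders of `φ` and comparison with powers -/

/-! The argument tests displacement convexity at a midpoint, without any transport inequality. The
reference measure `ν = σω` formally minimizes the entropy: since `u_φ` is convex with derivative
`ln_φ`, the density of `H_φ(μ)` minus that of the reference value `E` (`refEnergy`) is a Bregman
divergence, hence nonnegative, and the singular part of `μ` only adds to the entropy. So `H_φ ≥ E`
(`refEnergy_le_relEntropy`).

If the concentration function at `r` exceeds `ε`, there are a set `A` and the complement of its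
`r`-neighbourhood, both of `ν`-mass bounded below. Conditioning `ν` on bounded parts of the two
gives measures at Wasserstein distance at least `r`. If both have entropy at most `E + c`, convexity
at `t = 1/2` against the lower bound `E` forces `K r² ≤ 8c` (`IsKConvex.mul_sq_le`).

It remains to find `c` (`relEntropy_cond_le`). A conditioned measure has density `σ/ν(S)` on `S` and
`0` elsewhere, so two Bregman divergences must be bounded: from `σ` to a multiple of `σ`, and from
`σ` to `0`. With `p = max {1, θ_φ}`, the orders of `φ` give `1/φ(s) ≤ ξ^(p-δ) s^(-p)` for `0 < s ≤
ξ` (`inv_weight_le`), so both are at most a constant times `ξ^(p-δ) σ^(2-p)`. The power `σ^(2-p)` is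
integrable with a bound independent of `σ`: for `p = 1` it is a probability density, and for `p > 1`
the total mass of `ω` is finite. Hence `K ξ^(δ-p) r²` is bounded by a constant depending on `ε` but
not on the index, which the limit hypothesis excludes for large indices. -/

theorem rightDini_nonneg {φ : ℝ → ℝ} (hφ : IsAdmissibleWeight φ) {s : ℝ} (hs : 0 < s) :
    0 ≤ limsup (fun t : ℝ => (((φ (s + t) - φ s) / t : ℝ) : EReal)) (𝓝[>] 0) := by
  refine le_limsup_of_frequently_le (Eventually.frequently ?_)
  filter_upwards [self_mem_nhdsWithin] with t (ht : 0 < t)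
  have h := hφ.monotoneOn (mem_Ioi.2 hs) (mem_Ioi.2 (by linarith : 0 < s + t)) (by linarith)
  exact_mod_cast div_nonneg (sub_nonneg.2 h) ht.le

theorem localOrder_nonneg {φ : ℝ → ℝ} (hφ : IsAdmissibleWeight φ) {s : ℝ} (hs : 0 < s) :
    0 ≤ localOrder φ s :=
  mul_nonneg (by exact_mod_cast (div_pos hs (hφ.pos s hs)).le) (rightDini_nonneg hφ hs)

theorem delta_le_localOrder (φ : ℝ → ℝ) {s : ℝ} (hs : 0 < s) : delta φ ≤ localOrder φ s :=
  iInf₂_le s (mem_Ioi.2 hs)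

theorem localOrder_le_theta (φ : ℝ → ℝ) {s : ℝ} (hs : 0 < s) : localOrder φ s ≤ theta φ :=
  le_iSup₂ (f := fun s (_ : s ∈ Ioi (0 : ℝ)) => localOrder φ s) s (mem_Ioi.2 hs)

theorem delta_nonneg {φ : ℝ → ℝ} (hφ : IsAdmissibleWeight φ) : 0 ≤ delta φ :=
  le_iInf₂ fun _ hs => localOrder_nonneg hφ hs

theorem delta_le_theta (φ : ℝ → ℝ) : delta φ ≤ theta φ :=
  (delta_le_localOrder φ one_pos).trans (localOrder_le_theta φ one_pos)

theorem coe_toReal_theta {φ : ℝ → ℝ} (hφ : IsAdmissibleWeight φ) (hθ : theta φ < ⊤) :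
    ((theta φ).toReal : EReal) = theta φ :=
  EReal.coe_toReal hθ.ne
    (ne_bot_of_le_ne_bot EReal.zero_ne_bot ((delta_nonneg hφ).trans (delta_le_theta φ)))

theorem coe_toReal_delta {φ : ℝ → ℝ} (hφ : IsAdmissibleWeight φ) (hθ : theta φ < ⊤) :
    ((delta φ).toReal : EReal) = delta φ :=
  EReal.coe_toReal ((delta_le_theta φ).trans_lt hθ).ne
    (ne_bot_of_le_ne_bot EReal.zero_ne_bot (delta_nonneg hφ))

/-- Finiteness of `θ_φ` rules out an infinite upper Dini derivative, so the bounds on the local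
order become real differential inequalities for `φ`. -/
theorem exists_rightDini_eq {φ : ℝ → ℝ} (hφ : IsAdmissibleWeight φ) (hθ : theta φ < ⊤)
    {s : ℝ} (hs : 0 < s) :
    ∃ d : ℝ, limsup (fun t : ℝ => (((φ (s + t) - φ s) / t : ℝ) : EReal)) (𝓝[>] 0) = d ∧
      (delta φ).toReal * φ s / s ≤ d ∧ d ≤ (theta φ).toReal * φ s / s := by
  have hp := hφ.pos s hs
  have hle := localOrder_le_theta φ hs
  have hge := delta_le_localOrder φ hs
  have h0 := rightDini_nonneg hφ hs
  rw [← coe_toReal_theta hφ hθ] at hle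
  rw [← coe_toReal_delta hφ hθ] at hge
  unfold localOrder at hle hge
  generalize limsup (fun t : ℝ => (((φ (s + t) - φ s) / t : ℝ) : EReal)) (𝓝[>] 0) = d at *
  induction d with
  | bot => simp at h0
  | top =>
    rw [EReal.coe_mul_top_of_pos (div_pos hs hp)] at hle
    simp at hle
  | coe d =>
    refine ⟨d, rfl, ?_, ?_⟩
    · have h : (delta φ).toReal ≤ s / φ s * d := by exact_mod_cast hge
      rw [div_mul_eq_mul_div, le_div_iff₀ hp] at h
      rw [div_le_iff₀ hs]; linarith
    · have h : s / φ s * d ≤ (theta φ).toReal := by exact_mod_cast hle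
      rw [div_mul_eq_mul_div, div_le_iff₀ hp] at h
      rw [le_div_iff₀ hs]; linarith

theorem hasDerivAt_const_mul_div_rpow {a x : ℝ} (ha : 0 < a) (hx : 0 < x) (c q : ℝ) :
    HasDerivAt (fun y => c * (y / a) ^ q) (q * (c * (x / a) ^ q) / x) x := by
  have h1 : HasDerivAt (fun y : ℝ => y / a) (1 / a) x := (hasDerivAt_id x).div_const a
  have h2 := (h1.rpow_const (p := q) (Or.inl (div_pos hx ha).ne')).const_mul c
  refine h2.congr_deriv ?_
  rw [Real.rpow_sub_one (div_pos hx ha).ne']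
  field_simp

theorem tendsto_mul_rpow_nhdsWithin (c : ℝ) {y : ℝ} (hy : 0 < y) (q : ℝ) (s : Set ℝ) :
    Tendsto (fun q' : ℝ => c * y ^ q') (𝓝[s] q) (𝓝 (c * y ^ q)) :=
  (((Real.continuous_const_rpow hy.ne').tendsto q).const_mul c).mono_left nhdsWithin_le_nhds

theorem frequently_slope {a : ℝ} {P : ℝ → Prop}
    (h : ∃ᶠ t in 𝓝[>] (0 : ℝ), P (a + t)) : ∃ᶠ z in 𝓝[>] a, P z := by
  have ht : Tendsto (fun t : ℝ => a + t) (𝓝[>] 0) (𝓝[>] a) := by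
    refine tendsto_nhdsWithin_iff.2 ⟨?_, ?_⟩
    · have : Tendsto (fun t : ℝ => a + t) (𝓝 0) (𝓝 (a + 0)) :=
        (continuous_const.add continuous_id).tendsto 0
      rw [add_zero] at this
      exact this.mono_left nhdsWithin_le_nhds
    · filter_upwards [self_mem_nhdsWithin] with t (ht : 0 < t)
      exact mem_Ioi.2 (by linarith)
  exact ht.frequently h

/-- `φ(s) / s ^ θ_φ` is non-increasing. -/
theorem weight_le_mul_rpow_theta {φ : ℝ → ℝ} (hφ : IsAdmissibleWeight φ) (hθ : theta φ < ⊤)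
    {a b : ℝ} (ha : 0 < a) (hab : a ≤ b) : φ b ≤ φ a * (b / a) ^ (theta φ).toReal := by
  -- The barrier argument needs a strict derivative inequality at contact points, so the comparison
  -- is made with exponents `q > θ_φ` and then `q` decreases to `θ_φ`.
  refine ge_of_tendsto (tendsto_mul_rpow_nhdsWithin (φ a) (div_pos (ha.trans_le hab) ha) _
    (Ioi (theta φ).toReal)) ?_
  filter_upwards [self_mem_nhdsWithin] with q (hq : (theta φ).toReal < q)
  have hpos : ∀ x ∈ Icc a b, 0 < x := fun x hx => ha.trans_le hx.1
  refine image_le_of_liminf_slope_right_lt_deriv_boundary' (f := φ)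
    (f' := fun x => (theta φ).toReal * φ x / x) (B := fun x => φ a * (x / a) ^ q)
    (B' := fun x => q * (φ a * (x / a) ^ q) / x)
    (hφ.continuousOn.mono fun x hx => hpos x hx) ?_ (by simp [ha.ne'])
    (fun x hx => (hasDerivAt_const_mul_div_rpow ha (hpos x hx) _ _).continuousAt.continuousWithinAt)
    (fun x hx => (hasDerivAt_const_mul_div_rpow ha (ha.trans_le hx.1) _ _).hasDerivWithinAt)
    ?_ (right_mem_Icc.2 hab)
  · intro x hx r hr
    have hx0 : 0 < x := ha.trans_le hx.1
    obtain ⟨d, hd, -, hd2⟩ := exists_rightDini_eq hφ hθ hx0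
    refine frequently_slope (Eventually.frequently ?_)
    have hlt : limsup (fun t : ℝ => (((φ (x + t) - φ x) / t : ℝ) : EReal)) (𝓝[>] 0) < (r : EReal) := by
      rw [hd]; exact_mod_cast hd2.trans_lt hr
    filter_upwards [eventually_lt_of_limsup_lt hlt] with t ht
    rw [slope_def_field, add_sub_cancel_left]
    exact_mod_cast ht
  · intro x hx heq
    have hx0 : 0 < x := ha.trans_le hx.1
    rw [← heq]
    have := hφ.pos x hx0
    gcongr

/-- `φ(s) / s ^ δ_φ` is non-decreasing. -/
theorem mul_rpow_delta_le_weight {φ : ℝ → ℝ} (hφ : IsAdmissibleWeight φ) (hθ : theta φ < ⊤)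
    {a b : ℝ} (ha : 0 < a) (hab : a ≤ b) : φ a * (b / a) ^ (delta φ).toReal ≤ φ b := by
  refine le_of_tendsto (tendsto_mul_rpow_nhdsWithin (φ a) (div_pos (ha.trans_le hab) ha) _
    (Iio (delta φ).toReal)) ?_
  filter_upwards [self_mem_nhdsWithin] with q (hq : q < (delta φ).toReal)
  have hpos : ∀ x ∈ Icc a b, 0 < x := fun x hx => ha.trans_le hx.1
  refine neg_le_neg_iff.1 (image_le_of_liminf_slope_right_lt_deriv_boundary' (f := fun x => -φ x)
    (f' := fun x => -((delta φ).toReal * φ x / x)) (B := fun x => -(φ a * (x / a) ^ q))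
    (B' := fun x => -(q * (φ a * (x / a) ^ q) / x))
    (hφ.continuousOn.mono fun x hx => hpos x hx).neg ?_ (by simp [ha.ne'])
    (fun x hx =>
      (hasDerivAt_const_mul_div_rpow ha (hpos x hx) _ _).neg.continuousAt.continuousWithinAt)
    (fun x hx => (hasDerivAt_const_mul_div_rpow ha (ha.trans_le hx.1) _ _).neg.hasDerivWithinAt)
    ?_ (right_mem_Icc.2 hab))
  · intro x hx r hr
    have hx0 : 0 < x := ha.trans_le hx.1
    obtain ⟨d, hd, hd1, -⟩ := exists_rightDini_eq hφ hθ hx0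
    refine frequently_slope ?_
    have hlt : ((-r : ℝ) : EReal) <
        limsup (fun t : ℝ => (((φ (x + t) - φ x) / t : ℝ) : EReal)) (𝓝[>] 0) := by
      rw [hd]; exact_mod_cast (by linarith : -r < d)
    -- After the sign change only a lower Dini derivative of `-φ` is controlled, so small slopes
    -- occur frequently rather than eventually; the barrier lemma asks for no more.
    refine (frequently_lt_of_lt_limsup (by isBoundedDefault) hlt).mono fun t ht => ?_
    have ht' : -r < (φ (x + t) - φ x) / t := by exact_mod_cast ht
    rw [slope_def_field, add_sub_cancel_left]
    have : (-φ (x + t) - -φ x) / t = -((φ (x + t) - φ x) / t) := by ring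
    linarith
  · intro x hx heq
    have hx0 : 0 < x := ha.trans_le hx.1
    simp only [neg_inj] at heq
    rw [← heq, neg_lt_neg_iff]
    have := hφ.pos x hx0
    gcongr

theorem rpow_theta_le_weight {φ : ℝ → ℝ} (hφ : IsAdmissibleWeight φ) (hθ : theta φ < ⊤)
    (h1 : φ 1 = 1) {s : ℝ} (hs : 0 < s) (hs1 : s ≤ 1) : s ^ (theta φ).toReal ≤ φ s := by
  have h := weight_le_mul_rpow_theta hφ hθ hs hs1
  rw [h1, one_div, Real.inv_rpow hs.le, ← div_eq_mul_inv, le_div_iff₀ (by positivity)] at h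
  linarith

theorem weight_le_rpow_theta {φ : ℝ → ℝ} (hφ : IsAdmissibleWeight φ) (hθ : theta φ < ⊤)
    (h1 : φ 1 = 1) {s : ℝ} (hs1 : 1 ≤ s) : φ s ≤ s ^ (theta φ).toReal := by
  simpa [h1] using weight_le_mul_rpow_theta hφ hθ one_pos hs1

theorem rpow_delta_le_weight {φ : ℝ → ℝ} (hφ : IsAdmissibleWeight φ) (hθ : theta φ < ⊤)
    (h1 : φ 1 = 1) {s : ℝ} (hs1 : 1 ≤ s) : s ^ (delta φ).toReal ≤ φ s := by
  simpa [h1] using mul_rpow_delta_le_weight hφ hθ one_pos hs1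

/-- The exponent `max {1, θ_φ}`. -/
def maxOrder (φ : ℝ → ℝ) : ℝ := max 1 (theta φ).toReal

theorem delta_le_maxOrder {φ : ℝ → ℝ} (hφ : IsAdmissibleWeight φ) (hθ : theta φ < ⊤) :
    (delta φ).toReal ≤ maxOrder φ := by
  have h := delta_le_theta φ
  rw [← coe_toReal_theta hφ hθ, ← coe_toReal_delta hφ hθ, EReal.coe_le_coe_iff] at h
  exact h.trans (le_max_right _ _)

/-- Below `1` the order `θ_φ` bounds `φ` from below and the factor in `ξ` is at least `1`; above `1`
the order `δ_φ` does, and the excess `s^(p-δ)` is absorbed into `ξ^(p-δ)`. -/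
theorem inv_weight_le {φ : ℝ → ℝ} (hφ : IsAdmissibleWeight φ) (hθ : theta φ < ⊤)
    (h1 : φ 1 = 1) {s ξ : ℝ} (hs : 0 < s) (hsξ : s ≤ ξ) (hξ : 1 ≤ ξ) :
    (φ s)⁻¹ ≤ ξ ^ (maxOrder φ - (delta φ).toReal) * s ^ (-maxOrder φ) := by
  have hδp := delta_le_maxOrder hφ hθ
  rcases le_total s 1 with hs1 | hs1
  · have h2 : s ^ maxOrder φ ≤ φ s :=
      (Real.rpow_le_rpow_of_exponent_ge hs hs1 (le_max_right _ _)).trans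
        (rpow_theta_le_weight hφ hθ h1 hs hs1)
    calc (φ s)⁻¹ ≤ (s ^ maxOrder φ)⁻¹ := inv_anti₀ (by positivity) h2
      _ = 1 * s ^ (-maxOrder φ) := by rw [one_mul, Real.rpow_neg hs.le]
      _ ≤ _ := by
        gcongr
        exact Real.one_le_rpow hξ (by linarith)
  · calc (φ s)⁻¹ ≤ (s ^ (delta φ).toReal)⁻¹ :=
        inv_anti₀ (by positivity) (rpow_delta_le_weight hφ hθ h1 hs1)
      _ = s ^ (maxOrder φ - (delta φ).toReal) * s ^ (-maxOrder φ) := by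
        rw [← Real.rpow_add hs, ← Real.rpow_neg hs.le]; congr 1; ring
      _ ≤ _ := by
        gcongr

/-! ### The `φ`-logarithm and the function `u_φ` -/

theorem intervalIntegrable_inv_weight {φ : ℝ → ℝ} (hφ : IsAdmissibleWeight φ) {a b : ℝ}
    (ha : 0 < a) (hb : 0 < b) : IntervalIntegrable (fun s => (φ s)⁻¹) volume a b := by
  have hsub : uIcc a b ⊆ Ioi 0 := fun x hx => (lt_min ha hb).trans_le hx.1
  exact ((hφ.continuousOn.mono hsub).inv₀ fun x hx => (hφ.pos x (hsub hx)).ne').intervalIntegrable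

theorem lnPhi_sub_lnPhi {φ : ℝ → ℝ} (hφ : IsAdmissibleWeight φ) {a b : ℝ}
    (ha : 0 < a) (hb : 0 < b) : lnPhi φ b - lnPhi φ a = ∫ s in a..b, (φ s)⁻¹ :=
  intervalIntegral.integral_interval_sub_left (intervalIntegrable_inv_weight hφ one_pos hb)
    (intervalIntegrable_inv_weight hφ one_pos ha)

theorem lnPhi_strictMonoOn {φ : ℝ → ℝ} (hφ : IsAdmissibleWeight φ) :
    StrictMonoOn (lnPhi φ) (Ioi 0) := by
  intro a ha b hb hab
  rw [← sub_pos, lnPhi_sub_lnPhi hφ ha hb]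
  exact intervalIntegral.intervalIntegral_pos_of_pos_on (intervalIntegrable_inv_weight hφ ha hb)
    (fun x hx => inv_pos.2 (hφ.pos x (lt_trans ha hx.1))) hab

theorem lnPhi_continuousOn {φ : ℝ → ℝ} (hφ : IsAdmissibleWeight φ) :
    ContinuousOn (lnPhi φ) (Ioi 0) := by
  have hc : ContinuousOn (fun s => (φ s)⁻¹) (Ioi 0) :=
    hφ.continuousOn.inv₀ fun x hx => (hφ.pos x hx).ne'
  intro x hx
  exact (intervalIntegral.integral_hasDerivAt_right
    (intervalIntegrable_inv_weight hφ one_pos hx)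
    (hc.stronglyMeasurableAtFilter isOpen_Ioi x hx)
    (hc.continuousAt (Ioi_mem_nhds hx))).continuousAt.continuousWithinAt

theorem lnPhi_one (φ : ℝ → ℝ) : lnPhi φ 1 = 0 := by simp [lnPhi]

theorem lnPhi_sub_lnPhi_le_of_le {φ : ℝ → ℝ} (hφ : IsAdmissibleWeight φ) {a b : ℝ}
    (ha : 0 < a) (hab : a ≤ b) : lnPhi φ b - lnPhi φ a ≤ (b - a) * (φ a)⁻¹ := by
  rw [lnPhi_sub_lnPhi hφ ha (ha.trans_le hab)]
  calc ∫ s in a..b, (φ s)⁻¹ ≤ ∫ _s in a..b, (φ a)⁻¹ := by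
        refine intervalIntegral.integral_mono_on hab
          (intervalIntegrable_inv_weight hφ ha (ha.trans_le hab)) (by simp) fun x hx => ?_
        exact inv_anti₀ (hφ.pos a ha)
          (hφ.monotoneOn (mem_Ioi.2 ha) (mem_Ioi.2 (ha.trans_le hx.1)) hx.1)
    _ = (b - a) * (φ a)⁻¹ := by simp

/-- Splitting `x^(-p) = x^(-1/2) x^(1/2-p)` leaves two singularities that are both integrable at
`0`: the first factor is frozen at `t`, and the second is integrable because `p < 3/2`. The bound
controls `ln_φ` near `0`, which makes `u_φ` well defined. -/
theorem lnPhi_sub_lnPhi_le_rpow {φ : ℝ → ℝ} (hφ : IsAdmissibleWeight φ) (hθ : theta φ < ⊤)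
    (h1 : φ 1 = 1) (hp : maxOrder φ < 3 / 2) {t s ξ : ℝ} (ht : 0 < t) (hts : t ≤ s)
    (hsξ : s ≤ ξ) (hξ : 1 ≤ ξ) :
    lnPhi φ s - lnPhi φ t ≤ ξ ^ (maxOrder φ - (delta φ).toReal) *
      (s ^ (3 / 2 - maxOrder φ) / (3 / 2 - maxOrder φ)) * t ^ (-(1 / 2) : ℝ) := by
  have hs : 0 < s := ht.trans_le hts
  set p := maxOrder φ
  set D := ξ ^ (p - (delta φ).toReal)
  have hD : 0 < D := Real.rpow_pos_of_pos (by linarith) _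
  have hint : ∀ a, IntervalIntegrable (fun x : ℝ => D * t ^ (-(1 / 2) : ℝ) * x ^ (1 / 2 - p))
      volume a s := fun a => (intervalIntegral.intervalIntegrable_rpow' (by linarith)).const_mul _
  rw [lnPhi_sub_lnPhi hφ ht hs]
  calc ∫ x in t..s, (φ x)⁻¹ ≤ ∫ x in t..s, D * t ^ (-(1 / 2) : ℝ) * x ^ (1 / 2 - p) := by
        refine intervalIntegral.integral_mono_on hts
          (intervalIntegrable_inv_weight hφ ht hs) (hint t) fun x hx => ?_
        have hx0 : 0 < x := ht.trans_le hx.1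
        calc (φ x)⁻¹ ≤ D * x ^ (-p) := inv_weight_le hφ hθ h1 hx0 (hx.2.trans hsξ) hξ
          _ = D * (x ^ (-(1 / 2) : ℝ) * x ^ (1 / 2 - p)) := by
            rw [← Real.rpow_add hx0]; congr 2; ring
          _ ≤ D * (t ^ (-(1 / 2) : ℝ) * x ^ (1 / 2 - p)) := by
            gcongr D * (?_ * _)
            exact Real.rpow_le_rpow_of_nonpos ht hx.1 (by norm_num)
          _ = _ := by ring
    _ ≤ ∫ x in (0 : ℝ)..s, D * t ^ (-(1 / 2) : ℝ) * x ^ (1 / 2 - p) := by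
        refine intervalIntegral.integral_mono_interval ht.le hts le_rfl ?_ (hint 0)
        filter_upwards [ae_restrict_mem measurableSet_Ioc] with x hx
        have := hx.1
        simp only [Pi.zero_apply]
        positivity
    _ = _ := by
        rw [intervalIntegral.integral_const_mul, integral_rpow (Or.inl (by linarith)),
          Real.zero_rpow (by linarith)]
        rw [show (1 : ℝ) / 2 - p + 1 = 3 / 2 - p by ring]
        ring

theorem lnPhi_intervalIntegrable {φ : ℝ → ℝ} (hφ : IsAdmissibleWeight φ) (hθ : theta φ < ⊤)
    (h1 : φ 1 = 1) (hp : maxOrder φ < 3 / 2) {a b : ℝ} (ha : 0 ≤ a) (hb : 0 ≤ b) :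
    IntervalIntegrable (lnPhi φ) volume a b := by
  suffices h : ∀ c : ℝ, 0 ≤ c → IntervalIntegrable (lnPhi φ) volume 0 c from
    (h a ha).symm.trans (h b hb)
  intro c hc
  rcases hc.eq_or_lt with rfl | hc
  · simp
  set C := (max 1 c) ^ (maxOrder φ - (delta φ).toReal) *
      (c ^ (3 / 2 - maxOrder φ) / (3 / 2 - maxOrder φ))
  have hint : IntervalIntegrable (fun t : ℝ => |lnPhi φ c| + C * t ^ (-(1 / 2) : ℝ)) volume 0 c :=
    intervalIntegrable_const.add
      ((intervalIntegral.intervalIntegrable_rpow' (by norm_num)).const_mul _)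
  refine hint.mono_fun' ?_ ?_
  · rw [uIoc_of_le hc.le]
    exact ((lnPhi_continuousOn hφ).mono Ioc_subset_Ioi_self).aestronglyMeasurable measurableSet_Ioc
  · rw [uIoc_of_le hc.le]
    filter_upwards [ae_restrict_mem measurableSet_Ioc] with t ht
    have h := lnPhi_sub_lnPhi_le_rpow hφ hθ h1 hp ht.1 ht.2 (le_max_right 1 c) (le_max_left 1 c)
    have hm := (lnPhi_strictMonoOn hφ).monotoneOn (mem_Ioi.2 ht.1) (mem_Ioi.2 hc) ht.2
    change lnPhi φ c - lnPhi φ t ≤ C * t ^ (-(1 / 2) : ℝ) at h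
    rw [Real.norm_eq_abs, abs_le]
    constructor
    · linarith [neg_abs_le (lnPhi φ c)]
    · linarith [le_abs_self (lnPhi φ c)]

theorem uPhi_sub_uPhi {φ : ℝ → ℝ} (hφ : IsAdmissibleWeight φ) (hθ : theta φ < ⊤)
    (h1 : φ 1 = 1) (hp : maxOrder φ < 3 / 2) {a b : ℝ} (ha : 0 ≤ a) (hb : 0 ≤ b) :
    uPhi φ b - uPhi φ a = ∫ t in a..b, lnPhi φ t :=
  intervalIntegral.integral_interval_sub_left (lnPhi_intervalIntegrable hφ hθ h1 hp le_rfl hb)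
    (lnPhi_intervalIntegrable hφ hθ h1 hp le_rfl ha)

theorem uPhi_zero (φ : ℝ → ℝ) : uPhi φ 0 = 0 := by simp [uPhi]

theorem uPhi_continuousOn {φ : ℝ → ℝ} (hφ : IsAdmissibleWeight φ) (hθ : theta φ < ⊤)
    (h1 : φ 1 = 1) (hp : maxOrder φ < 3 / 2) : ContinuousOn (uPhi φ) (Ici 0) := by
  intro x hx
  have hx1 : (0 : ℝ) ≤ x + 1 := by linarith [mem_Ici.1 hx]
  have h : ContinuousOn (uPhi φ) (uIcc 0 (x + 1)) :=
    intervalIntegral.continuousOn_primitive_interval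
      (by rw [uIcc_of_le hx1, integrableOn_Icc_iff_integrableOn_Ioc]
          exact (intervalIntegrable_iff_integrableOn_Ioc_of_le hx1).1
            (lnPhi_intervalIntegrable hφ hθ h1 hp le_rfl hx1))
  rw [uIcc_of_le hx1] at h
  refine (h x ⟨hx, by linarith⟩).mono_of_mem_nhdsWithin ?_
  rw [← Ici_inter_Iic]
  exact inter_mem_nhdsWithin _ (Iic_mem_nhds (by linarith))

/-! ### Bregman divergence of `u_φ` -/

theorem bregman_nonneg {φ : ℝ → ℝ} (hφ : IsAdmissibleWeight φ) (hθ : theta φ < ⊤)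
    (h1 : φ 1 = 1) (hp : maxOrder φ < 3 / 2) {r s : ℝ} (hr : 0 ≤ r) (hs : 0 < s) :
    0 ≤ uPhi φ r - uPhi φ s - lnPhi φ s * (r - s) := by
  have hi : ∀ {a b : ℝ}, 0 ≤ a → 0 ≤ b → IntervalIntegrable (lnPhi φ) volume a b :=
    lnPhi_intervalIntegrable hφ hθ h1 hp
  have hm := (lnPhi_strictMonoOn hφ).monotoneOn
  rcases le_total s r with hsr | hrs
  · have := intervalIntegral.integral_mono_on_of_le_Ioo (f := fun _ => lnPhi φ s) hsr
      intervalIntegrable_const (hi hs.le hr)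
      fun t ht => hm (mem_Ioi.2 hs) (mem_Ioi.2 (hs.trans ht.1)) ht.1.le
    rw [← uPhi_sub_uPhi hφ hθ h1 hp hs.le hr, intervalIntegral.integral_const, smul_eq_mul] at this
    linarith
  · have := intervalIntegral.integral_mono_on_of_le_Ioo (g := fun _ => lnPhi φ s) hrs
      (hi hr hs.le) intervalIntegrable_const
      fun t ht => hm (mem_Ioi.2 (hr.trans_lt ht.1)) (mem_Ioi.2 hs) ht.2.le
    rw [← uPhi_sub_uPhi hφ hθ h1 hp hr hs.le, intervalIntegral.integral_const, smul_eq_mul] at this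
    linarith

/-- Tangent-line inequality at the boundary point `0`; it replaces `bregman_nonneg` where the
reference density vanishes. -/
theorem mul_le_uPhi {φ : ℝ → ℝ} (hφ : IsAdmissibleWeight φ) (hθ : theta φ < ⊤)
    (h1 : φ 1 = 1) (hp : maxOrder φ < 3 / 2) {r l : ℝ} (hr : 0 ≤ r)
    (hl : ∀ t, 0 < t → l ≤ lnPhi φ t) : l * r ≤ uPhi φ r := by
  have := intervalIntegral.integral_mono_on_of_le_Ioo (f := fun _ => l) hr
    intervalIntegrable_const (lnPhi_intervalIntegrable hφ hθ h1 hp le_rfl hr)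
    fun t ht => hl t ht.1
  rw [intervalIntegral.integral_const, smul_eq_mul] at this
  unfold uPhi
  linarith

/-- The divergence is at most the increment `(c-1)s` times the growth of `ln_φ` over it, and that
growth is at most `(c-1)s/φ(s)` since `φ` is non-decreasing. -/
theorem bregman_mul_le {φ : ℝ → ℝ} (hφ : IsAdmissibleWeight φ) (hθ : theta φ < ⊤)
    (h1 : φ 1 = 1) (hp : maxOrder φ < 3 / 2) {s ξ c : ℝ} (hs : 0 < s) (hsξ : s ≤ ξ)
    (hξ : 1 ≤ ξ) (hc : 1 ≤ c) :
    uPhi φ (c * s) - uPhi φ s - lnPhi φ s * (c * s - s) ≤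
      c ^ 2 * (ξ ^ (maxOrder φ - (delta φ).toReal) * s ^ (2 - maxOrder φ)) := by
  have hcs : s ≤ c * s := le_mul_of_one_le_left hs.le hc
  have hm := (lnPhi_strictMonoOn hφ).monotoneOn
  have h2 := intervalIntegral.integral_mono_on_of_le_Ioo (g := fun _ => lnPhi φ (c * s)) hcs
    (lnPhi_intervalIntegrable hφ hθ h1 hp hs.le (by positivity)) intervalIntegrable_const
    fun t ht => hm (mem_Ioi.2 (hs.trans ht.1)) (mem_Ioi.2 (by positivity)) ht.2.le
  rw [← uPhi_sub_uPhi hφ hθ h1 hp hs.le (by positivity), intervalIntegral.integral_const,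
    smul_eq_mul] at h2
  have h3 := lnPhi_sub_lnPhi_le_of_le hφ hs hcs
  have h4 := inv_weight_le hφ hθ h1 hs hsξ hξ
  have h5 : s ^ 2 * s ^ (-maxOrder φ) = s ^ (2 - maxOrder φ) := by
    rw [← Real.rpow_natCast s 2, ← Real.rpow_add hs]; congr 1
  have hφs := hφ.pos s hs
  calc uPhi φ (c * s) - uPhi φ s - lnPhi φ s * (c * s - s)
      ≤ (c * s - s) * (lnPhi φ (c * s) - lnPhi φ s) := by linarith
    _ ≤ (c * s - s) * ((c * s - s) * (φ s)⁻¹) := by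
      gcongr
    _ = (c - 1) ^ 2 * s ^ 2 * (φ s)⁻¹ := by ring
    _ ≤ c ^ 2 * s ^ 2 * (ξ ^ (maxOrder φ - (delta φ).toReal) * s ^ (-maxOrder φ)) := by
      gcongr ?_ ^ 2 * s ^ 2 * ?_
      · linarith
    _ = _ := by rw [← h5]; ring

/-- The divergence to `0` is the integral of `ln_φ s - ln_φ t` over `0 < t < s`; integrating
`t^(-1/2)` produces the factor `2`. -/
theorem bregman_zero_le {φ : ℝ → ℝ} (hφ : IsAdmissibleWeight φ) (hθ : theta φ < ⊤)
    (h1 : φ 1 = 1) (hp : maxOrder φ < 3 / 2) {s ξ : ℝ} (hs : 0 < s) (hsξ : s ≤ ξ)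
    (hξ : 1 ≤ ξ) :
    uPhi φ 0 - uPhi φ s - lnPhi φ s * (0 - s) ≤
      2 / (3 / 2 - maxOrder φ) *
        (ξ ^ (maxOrder φ - (delta φ).toReal) * s ^ (2 - maxOrder φ)) := by
  set A := ξ ^ (maxOrder φ - (delta φ).toReal) *
      (s ^ (3 / 2 - maxOrder φ) / (3 / 2 - maxOrder φ)) with hA
  have hi := lnPhi_intervalIntegrable hφ hθ h1 hp le_rfl hs.le
  have h2 := intervalIntegral.integral_mono_on_of_le_Ioo
    (f := fun t => lnPhi φ s - lnPhi φ t) (g := fun t => A * t ^ (-(1 / 2) : ℝ)) hs.le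
    (intervalIntegrable_const.sub hi)
    ((intervalIntegral.intervalIntegrable_rpow' (by norm_num)).const_mul _)
    fun t ht => lnPhi_sub_lnPhi_le_rpow hφ hθ h1 hp ht.1 ht.2.le hsξ hξ
  rw [intervalIntegral.integral_sub intervalIntegrable_const hi, intervalIntegral.integral_const,
    intervalIntegral.integral_const_mul, integral_rpow (Or.inl (by norm_num)),
    Real.zero_rpow (by norm_num), smul_eq_mul] at h2
  have h5 : s ^ (3 / 2 - maxOrder φ) * s ^ (-(1 / 2) + 1 : ℝ) = s ^ (2 - maxOrder φ) := by
    rw [← Real.rpow_add hs]; congr 1; ring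
  change (s - 0) * lnPhi φ s - uPhi φ s ≤ _ at h2
  rw [uPhi_zero]
  calc _ = (s - 0) * lnPhi φ s - uPhi φ s := by ring
    _ ≤ _ := h2
    _ = _ := by rw [hA, ← h5]; ring

/-! ### The reference density -/

theorem lowerLim_le (φ : ℝ → ℝ) {t : ℝ} (ht : 0 < t) : lowerLim φ ≤ (lnPhi φ t : EReal) :=
  iInf₂_le t (mem_Ioi.2 ht)

theorem le_upperLim (φ : ℝ → ℝ) {t : ℝ} (ht : 0 < t) : (lnPhi φ t : EReal) ≤ upperLim φ :=
  le_iSup₂ (f := fun t (_ : t ∈ Ioi (0 : ℝ)) => (lnPhi φ t : EReal)) t (mem_Ioi.2 ht)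

theorem upperLim_ne_bot (φ : ℝ → ℝ) : upperLim φ ≠ ⊥ :=
  ne_bot_of_le_ne_bot (EReal.coe_ne_bot _) (le_upperLim φ one_pos)

theorem isAdmissibleWeight_powerWeight {m : ℝ} (hm : m ≤ 2) :
    IsAdmissibleWeight (powerWeight m) where
  pos s hs := Real.rpow_pos_of_pos hs _
  monotoneOn a ha b _ hab := Real.rpow_le_rpow (le_of_lt ha) hab (by linarith)
  continuousOn := fun x hx =>
    (Real.continuousAt_rpow_const x _ (Or.inl (ne_of_gt hx))).continuousWithinAt

/-- Since `φ(s) ≤ s^θ` for `s ≥ 1`, the admissibility bound on the potential implies `Ψ > -L_φ`, so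
the reference density is never infinite. -/
theorem upperLim_powerWeight_le {φ : ℝ → ℝ} (hφ : IsAdmissibleWeight φ) (hθ : theta φ < ⊤)
    (h1 : φ 1 = 1) : upperLim (powerWeight (2 - (theta φ).toReal)) ≤ upperLim φ := by
  have hθ0 : 0 ≤ (theta φ).toReal :=
    EReal.toReal_nonneg ((delta_nonneg hφ).trans (delta_le_theta φ))
  have hpw := isAdmissibleWeight_powerWeight (m := 2 - (theta φ).toReal) (by linarith)
  refine iSup₂_le fun t ht => ?_
  rcases le_total t 1 with h | h
  · refine le_trans ?_ (le_upperLim φ one_pos)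
    rw [lnPhi_one, ← lnPhi_one (powerWeight (2 - (theta φ).toReal)), EReal.coe_le_coe_iff]
    exact (lnPhi_strictMonoOn hpw).monotoneOn ht (mem_Ioi.2 one_pos) h
  · refine le_trans ?_ (le_upperLim φ ht)
    rw [EReal.coe_le_coe_iff]
    refine intervalIntegral.integral_mono_on h (intervalIntegrable_inv_weight hpw one_pos ht)
      (intervalIntegrable_inv_weight hφ one_pos ht) fun x hx => ?_
    refine inv_anti₀ (hφ.pos x (by linarith [hx.1])) ?_
    have := weight_le_rpow_theta hφ hθ h1 hx.1
    simpa [powerWeight] using this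

theorem exists_expPhi_eq {φ : ℝ → ℝ} (hφ : IsAdmissibleWeight φ) {τ : ℝ}
    (hl : lowerLim φ < τ) (hL : (τ : EReal) < upperLim φ) :
    ∃ t : ℝ, 0 < t ∧ lnPhi φ t = τ ∧ expPhi φ τ = ENNReal.ofReal t := by
  have hex : ∃ t ∈ Ioi (0 : ℝ), lnPhi φ t = τ := by
    obtain ⟨a, h⟩ := iInf_lt_iff.1 hl
    obtain ⟨ha, ha'⟩ := iInf_lt_iff.1 h
    obtain ⟨b, h'⟩ := lt_iSup_iff.1 hL
    obtain ⟨hb, hb'⟩ := lt_iSup_iff.1 h'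
    exact isPreconnected_Ioi.intermediate_value ha hb (lnPhi_continuousOn hφ)
      ⟨by exact_mod_cast ha'.le, by exact_mod_cast hb'.le⟩
  refine ⟨Function.invFunOn (lnPhi φ) (Ioi 0) τ, Function.invFunOn_mem hex,
    Function.invFunOn_eq hex, ?_⟩
  rw [expPhi, if_neg hl.not_ge, if_neg hL.not_ge]

theorem expPhi_monotone {φ : ℝ → ℝ} (hφ : IsAdmissibleWeight φ) : Monotone (expPhi φ) := by
  intro a b hab
  have hab' : (a : EReal) ≤ b := by exact_mod_cast hab
  rcases le_or_gt (a : EReal) (lowerLim φ) with ha | ha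
  · simp [expPhi, ha]
  rcases le_or_gt (upperLim φ) (b : EReal) with hb | hb
  · simp [expPhi, hb, (ha.trans_le hab').not_ge]
  obtain ⟨s, hs, hsa, hs'⟩ := exists_expPhi_eq hφ ha (hab'.trans_lt hb)
  obtain ⟨t, ht, htb, ht'⟩ := exists_expPhi_eq hφ (ha.trans_le hab') hb
  rw [hs', ht']
  refine ENNReal.ofReal_le_ofReal (((lnPhi_strictMonoOn hφ).le_iff_le hs ht).1 ?_)
  rwa [hsa, htb]

theorem measurable_refDensity {M : Type*} [TopologicalSpace M] [MeasurableSpace M] [BorelSpace M]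
    {φ : ℝ → ℝ} (hφ : IsAdmissibleWeight φ) {Ψ : M → ℝ} (hΨ : Continuous Ψ) :
    Measurable (refDensity φ Ψ) :=
  (expPhi_monotone hφ).measurable.comp hΨ.neg.measurable

/-- The finite part of `L_φ`, and `0` if `L_φ = ∞`. -/
def upperShift (φ : ℝ → ℝ) : ℝ := if upperLim φ = ⊤ then 0 else (upperLim φ).toReal

theorem hPhi_eq (φ : ℝ → ℝ) (r : ℝ) : hPhi φ r = uPhi φ r - r * upperShift φ := by
  unfold hPhi upperShift; split_ifs <;> simp

/-- When the density vanishes, `-Ψ x ≤ l_φ` forces `l_φ` to be finite, so the slope prescribed there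
is a genuine lower bound of `ln_φ`. -/
theorem refDensity_cases {M : Type*} {φ : ℝ → ℝ} (hφ : IsAdmissibleWeight φ) {Ψ : M → ℝ} {x : M}
    (hx : -upperLim φ < (Ψ x : EReal)) :
    refDensity φ Ψ x ≠ ⊤ ∧
    ((0 < (refDensity φ Ψ x).toReal ∧
        hPhiDerivRef φ Ψ x = lnPhi φ (refDensity φ Ψ x).toReal - upperShift φ) ∨
      ((refDensity φ Ψ x).toReal = 0 ∧
        ∃ l : ℝ, (∀ t, 0 < t → l ≤ lnPhi φ t) ∧ hPhiDerivRef φ Ψ x = l - upperShift φ)) := by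
  have hL : ((-Ψ x : ℝ) : EReal) < upperLim φ := by
    rw [EReal.coe_neg]; exact EReal.neg_lt_comm.1 hx
  rcases le_or_gt ((-Ψ x : ℝ) : EReal) (lowerLim φ) with h | h
  · have h0 : refDensity φ Ψ x = 0 := by simp only [refDensity, expPhi, if_pos h]
    have hmem : x ∉ effectiveDomain φ Ψ := fun hm => by
      have := EReal.lt_neg_comm.1 hm.2
      rw [← EReal.coe_neg] at this
      exact this.not_ge h
    refine ⟨by simp [h0], Or.inr ⟨by simp [h0], (lowerLim φ).toReal, fun t ht => ?_, ?_⟩⟩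
    · have h2 := lowerLim_le φ ht
      have hb : lowerLim φ ≠ ⊥ := ne_bot_of_le_ne_bot (EReal.coe_ne_bot _) h
      rw [← EReal.coe_toReal (h2.trans_lt (EReal.coe_lt_top _)).ne hb] at h2
      exact_mod_cast h2
    · simp [hPhiDerivRef, if_neg hmem, upperShift]
  · obtain ⟨t, ht, -, ht'⟩ := exists_expPhi_eq hφ h hL
    have hmem : x ∈ effectiveDomain φ Ψ :=
      ⟨hx, EReal.lt_neg_comm.1 (by rw [← EReal.coe_neg]; exact h)⟩
    have h0 : refDensity φ Ψ x = ENNReal.ofReal t := ht'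
    refine ⟨by simp [h0], Or.inl ⟨by simpa [h0, ENNReal.toReal_ofReal ht.le] using ht, ?_⟩⟩
    simp [hPhiDerivRef, if_pos hmem, upperShift]

/-! ### Pointwise estimates of the entropy density -/

theorem hPhiDerivRef_mul_refDensity {M : Type*} {φ : ℝ → ℝ} (hφ : IsAdmissibleWeight φ)
    {Ψ : M → ℝ} {x : M} (hx : -upperLim φ < (Ψ x : EReal)) :
    (refDensity φ Ψ x).toReal * hPhiDerivRef φ Ψ x =
      (refDensity φ Ψ x).toReal * lnPhi φ (refDensity φ Ψ x).toReal
        - (refDensity φ Ψ x).toReal * upperShift φ := by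
  obtain ⟨-, ⟨-, h⟩ | ⟨h, -⟩⟩ := refDensity_cases hφ hx
  · rw [h]; ring
  · rw [h]; ring

theorem hPhiDerivRef_nonpos {M : Type*} {φ : ℝ → ℝ} (hφ : IsAdmissibleWeight φ)
    {Ψ : M → ℝ} {x : M} (hx : -upperLim φ < (Ψ x : EReal)) (hL : upperLim φ ≠ ⊤) :
    hPhiDerivRef φ Ψ x ≤ 0 := by
  have h : ∀ t, 0 < t → lnPhi φ t ≤ upperShift φ := fun t ht => by
    have h2 := le_upperLim φ ht
    rw [← EReal.coe_toReal hL (upperLim_ne_bot φ)] at h2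
    rw [upperShift, if_neg hL]
    exact_mod_cast h2
  obtain ⟨-, ⟨h0, h1⟩ | ⟨-, l, hl, h1⟩⟩ := refDensity_cases hφ hx
  · rw [h1]; linarith [h _ h0]
  · rw [h1]; linarith [h 1 one_pos, hl 1 one_pos]

/-- The linear shift by `L_φ` cancels between `h_φ` and its derivative, leaving the convexity of
`u_φ`. -/
theorem entropyDensity_ge {M : Type*} {φ : ℝ → ℝ} (hφ : IsAdmissibleWeight φ) (hθ : theta φ < ⊤)
    (h1 : φ 1 = 1) (hp : maxOrder φ < 3 / 2) {Ψ : M → ℝ} {x : M}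
    (hx : -upperLim φ < (Ψ x : EReal)) {r : ℝ} (hr : 0 ≤ r) :
    hPhi φ (refDensity φ Ψ x).toReal - (refDensity φ Ψ x).toReal * hPhiDerivRef φ Ψ x ≤
      hPhi φ r - r * hPhiDerivRef φ Ψ x := by
  rw [hPhi_eq, hPhi_eq]
  obtain ⟨-, ⟨h0, h⟩ | ⟨h0, l, hl, h⟩⟩ := refDensity_cases hφ hx
  · rw [h]
    linarith [bregman_nonneg hφ hθ h1 hp hr h0]
  · rw [h, h0, uPhi_zero]
    linarith [mul_le_uPhi hφ hθ h1 hp hr hl]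

theorem entropyDensity_mul_le {M : Type*} {φ : ℝ → ℝ} (hφ : IsAdmissibleWeight φ)
    (hθ : theta φ < ⊤) (h1 : φ 1 = 1) (hp : maxOrder φ < 3 / 2) {Ψ : M → ℝ} {x : M}
    (hx : -upperLim φ < (Ψ x : EReal)) {ξ c : ℝ} (hξ : 1 ≤ ξ)
    (hsξ : (refDensity φ Ψ x).toReal ≤ ξ) (hc : 1 ≤ c) :
    hPhi φ (c * (refDensity φ Ψ x).toReal)
        - c * (refDensity φ Ψ x).toReal * hPhiDerivRef φ Ψ x ≤
      hPhi φ (refDensity φ Ψ x).toReal - (refDensity φ Ψ x).toReal * hPhiDerivRef φ Ψ x +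
        c ^ 2 * (ξ ^ (maxOrder φ - (delta φ).toReal) *
          (refDensity φ Ψ x).toReal ^ (2 - maxOrder φ)) := by
  rw [hPhi_eq, hPhi_eq]
  obtain ⟨-, ⟨h0, h⟩ | ⟨h0, -⟩⟩ := refDensity_cases hφ hx
  · rw [h]
    linarith [bregman_mul_le hφ hθ h1 hp h0 hsξ hξ hc]
  · rw [h0, mul_zero, le_add_iff_nonneg_right]
    positivity

theorem entropyDensity_zero_le {M : Type*} {φ : ℝ → ℝ} (hφ : IsAdmissibleWeight φ)
    (hθ : theta φ < ⊤) (h1 : φ 1 = 1) (hp : maxOrder φ < 3 / 2) {Ψ : M → ℝ} {x : M}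
    (hx : -upperLim φ < (Ψ x : EReal)) {ξ : ℝ} (hξ : 1 ≤ ξ)
    (hsξ : (refDensity φ Ψ x).toReal ≤ ξ) :
    0 ≤ hPhi φ (refDensity φ Ψ x).toReal - (refDensity φ Ψ x).toReal * hPhiDerivRef φ Ψ x +
        2 / (3 / 2 - maxOrder φ) * (ξ ^ (maxOrder φ - (delta φ).toReal) *
          (refDensity φ Ψ x).toReal ^ (2 - maxOrder φ)) := by
  rw [hPhi_eq]
  obtain ⟨-, ⟨h0, h⟩ | ⟨h0, -⟩⟩ := refDensity_cases hφ hx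
  · rw [h]
    linarith [bregman_zero_le hφ hθ h1 hp h0 hsξ hξ, uPhi_zero φ]
  · rw [h0, uPhi_zero]
    have : 0 < 3 / 2 - maxOrder φ := by linarith
    have : 0 ≤ 2 / (3 / 2 - maxOrder φ) * (ξ ^ (maxOrder φ - (delta φ).toReal) *
      (0 : ℝ) ^ (2 - maxOrder φ)) := by positivity
    linarith

/-! ### The weighted volume is σ-finite -/

theorem sigmaFinite_of_countable_cover {α ι : Type*} [Countable ι] [MeasurableSpace α]
    {μ : Measure α} (s : ι → Set α) (hs : ∀ i, μ (s i) < ⊤) (hU : ⋃ i, s i = univ) :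
    SigmaFinite μ := by
  cases isEmpty_or_nonempty ι
  · have : μ = 0 := by
      rw [← Measure.measure_univ_eq_zero, ← hU]; simp
    rw [this]; infer_instance
  · obtain ⟨e, he⟩ := exists_surjective_nat ι
    exact ⟨⟨⟨fun k => s (e k), fun _ => trivial, fun k => hs _, by rw [he.iUnion_comp, hU]⟩⟩⟩

theorem exists_cover_chartVolume_lt_top (n : ℕ) {M : Type*} [TopologicalSpace M]
    [ChartedSpace (EuclideanSpace ℝ (Fin n)) M]
    [RiemannianBundle (fun x : M => TangentSpace (𝓡 n) x)] [MeasurableSpace M] [BorelSpace M]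
    (p : M) : ∃ s : ℕ → Set M, (∀ k, MeasurableSet (s k)) ∧ (∀ k, chartVolume n p (s k) < ⊤) ∧
      (chartAt (EuclideanSpace ℝ (Fin n)) p).source ⊆ ⋃ k, s k := by
  set e := chartAt (EuclideanSpace ℝ (Fin n)) p with he
  set m := (volume.restrict e.target).withDensity
    (fun y => ENNReal.ofReal (Real.sqrt (gramDet n p y))) with hm
  have hac : m ≪ volume.restrict e.target := withDensity_absolutelyContinuous _ _
  have hmeas : AEMeasurable e.symm m :=
    (e.continuousOn_symm.aemeasurable e.open_target.measurableSet).mono_ac hac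
  have hsrc : ∀ t, MeasurableSet t → MeasurableSet (e.source ∩ e ⁻¹' t) := fun t ht => by
    have h := (continuousOn_iff_continuous_domRestrict.1 e.continuousOn).measurable ht
    have h2 := (MeasurableEmbedding.subtype_coe e.open_source.measurableSet).measurableSet_image.2 h
    convert h2 using 1
    ext x
    simp [and_comm]
  refine ⟨fun k => e.source ∩ e ⁻¹' (spanningSets m k),
    fun k => hsrc _ (measurableSet_spanningSets m k), fun k => ?_, ?_⟩
  · change Measure.map e.symm m _ < ⊤
    rw [Measure.map_apply_of_aemeasurable hmeas (hsrc _ (measurableSet_spanningSets m k))]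
    refine lt_of_le_of_lt ?_ (measure_spanningSets_lt_top m k)
    refine measure_mono_ae ?_
    filter_upwards [hac.ae_le (ae_restrict_mem e.open_target.measurableSet)] with y hy hyk
    have := hyk.2
    rwa [mem_preimage, e.right_inv hy] at this
  · rw [← inter_iUnion, ← preimage_iUnion, iUnion_spanningSets]
    simp

/-- On each disjoint piece only one summand charges, so finite-measure covers of the individual
charts combine. This gives access to Lebesgue decompositions with respect to `ω`. -/
theorem sigmaFinite_riemannianVolume (n : ℕ) (M : Type*) [TopologicalSpace M]
    [SecondCountableTopology M] [Nonempty M] [ChartedSpace (EuclideanSpace ℝ (Fin n)) M]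
    [RiemannianBundle (fun x : M => TangentSpace (𝓡 n) x)] [MeasurableSpace M] [BorelSpace M] :
    SigmaFinite (riemannianVolume n M) := by
  set S : ℕ → Set M := fun j => (chartAt (EuclideanSpace ℝ (Fin n)) (coverPoint n M j)).source
  have hSU : ⋃ j, S j = univ := Classical.choose_spec (exists_chart_cover n M)
  have hSm : ∀ i, MeasurableSet (disjointed S i) := fun i =>
    MeasurableSet.disjointed
      (fun j => (chartAt (EuclideanSpace ℝ (Fin n)) (coverPoint n M j)).open_source.measurableSet) i
  choose s hsm hs hsU using fun i => exists_cover_chartVolume_lt_top n (coverPoint n M i)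
  refine sigmaFinite_of_countable_cover (ι := ℕ × ℕ)
    (fun q => disjointed S q.1 ∩ s q.1 q.2) (fun q => ?_) ?_
  · rw [riemannianVolume, Measure.sum_apply _ ((hSm _).inter (hsm _ _)), tsum_eq_single q.1]
    · exact ((Measure.restrict_apply_le _ _).trans (measure_mono inter_subset_right)).trans_lt
        (hs q.1 q.2)
    · intro j hj
      rw [Measure.restrict_apply ((hSm _).inter (hsm _ _))]
      have hd : Disjoint (disjointed S q.1) (disjointed S j) := disjoint_disjointed S hj.symm
      rw [inter_right_comm, hd.inter_eq, empty_inter, measure_empty]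
  · refine eq_univ_of_forall fun x => ?_
    have hx : x ∈ ⋃ i, disjointed S i := by rw [iUnion_disjointed, hSU]; trivial
    obtain ⟨i, hi⟩ := mem_iUnion.1 hx
    obtain ⟨k, hk⟩ := mem_iUnion.1 (hsU i (disjointed_subset S i hi))
    exact mem_iUnion.2 ⟨(i, k), hi, hk⟩

/-! ### Bounds for the relative entropy -/

theorem integrable_toReal_refDensity {M : Type*} [TopologicalSpace M] [MeasurableSpace M]
    [BorelSpace M] {ω₀ : Measure M} {φ : ℝ → ℝ} (hφ : IsAdmissibleWeight φ) {Ψ : M → ℝ}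
    (hΨ : Continuous Ψ) (hprob : IsProbabilityMeasure (refMeasure ω₀ φ Ψ)) :
    Integrable (fun x => (refDensity φ Ψ x).toReal) ω₀ ∧
      ∫ x, (refDensity φ Ψ x).toReal ∂ω₀ = 1 := by
  have h1 : ∫⁻ x, refDensity φ Ψ x ∂ω₀ = 1 := by
    rw [← hprob.measure_univ, refMeasure, withDensity_apply _ MeasurableSet.univ,
      Measure.restrict_univ]
  have hm := measurable_refDensity hφ hΨ
  have hne : ∫⁻ x, refDensity φ Ψ x ∂ω₀ ≠ ⊤ := by simp [h1]
  refine ⟨integrable_toReal_of_lintegral_ne_top hm.aemeasurable hne, ?_⟩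
  rw [integral_toReal hm.aemeasurable (ae_lt_top hm hne), h1, ENNReal.toReal_one]

theorem integrable_rpow_and_integral_le {M : Type*} [MeasurableSpace M] {ω₀ : Measure M}
    {s : M → ℝ} (h0 : ∀ x, 0 ≤ s x) (hs : Integrable s ω₀) (h1 : ∫ x, s x ∂ω₀ = 1) {q : ℝ}
    (hq0 : 0 ≤ q) (hq1 : q ≤ 1) (hfin : q < 1 → ω₀ univ < ⊤) :
    Integrable (fun x => s x ^ q) ω₀ ∧ ∫ x, s x ^ q ∂ω₀ ≤ 1 + ω₀.real univ := by
  rcases hq1.eq_or_lt with rfl | hq1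
  · simp only [Real.rpow_one]
    -- The total mass may be infinite here; its real value is then `0` and the bound still holds.
    exact ⟨hs, by rw [h1]; linarith [measureReal_nonneg (μ := ω₀) (s := univ)]⟩
  have : IsFiniteMeasure ω₀ := ⟨hfin hq1⟩
  have hle : ∀ x, s x ^ q ≤ 1 + s x := fun x => by
    rcases le_total (s x) 1 with h | h
    · linarith [Real.rpow_le_one (h0 x) h hq0, h0 x]
    · have := Real.rpow_le_rpow_of_exponent_le h hq1.le
      rw [Real.rpow_one] at this
      linarith
  have hi2 : Integrable (fun x => 1 + s x) ω₀ := (integrable_const 1).add hs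
  have hi : Integrable (fun x => s x ^ q) ω₀ :=
    hi2.mono' (hs.aemeasurable.pow_const q).aestronglyMeasurable (ae_of_all _ fun x => by
      rw [Real.norm_of_nonneg (Real.rpow_nonneg (h0 x) q)]; exact hle x)
  refine ⟨hi, (integral_mono hi hi2 hle).trans_eq ?_⟩
  rw [integral_add (integrable_const 1) hs, h1, integral_const]
  simp [add_comm]

/-- The formal value of the relative entropy at the reference measure. -/
def refEnergy {M : Type*} [MeasurableSpace M] (ω₀ : Measure M) (φ : ℝ → ℝ) (Ψ : M → ℝ) : ℝ :=
  ∫ x, (hPhi φ (refDensity φ Ψ x).toReal - (refDensity φ Ψ x).toReal * hPhiDerivRef φ Ψ x) ∂ω₀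

theorem hPhi_continuousOn {φ : ℝ → ℝ} (hφ : IsAdmissibleWeight φ) (hθ : theta φ < ⊤)
    (h1 : φ 1 = 1) (hp : maxOrder φ < 3 / 2) : ContinuousOn (hPhi φ) (Ici 0) :=
  ((uPhi_continuousOn hφ hθ h1 hp).sub (continuousOn_id.mul continuousOn_const)).congr
    fun r _ => hPhi_eq φ r

theorem measurable_hPhi_comp {M : Type*} [MeasurableSpace M] {φ : ℝ → ℝ}
    (hφ : IsAdmissibleWeight φ) (hθ : theta φ < ⊤) (h1 : φ 1 = 1) (hp : maxOrder φ < 3 / 2)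
    {s : M → ℝ} (hs : Measurable s) (h0 : ∀ x, 0 ≤ s x) : Measurable fun x => hPhi φ (s x) := by
  have hc : Continuous fun y => hPhi φ (max y 0) :=
    (hPhi_continuousOn hφ hθ h1 hp).comp_continuous (continuous_id.max continuous_const)
      fun y => mem_Ici.2 (le_max_right _ _)
  simpa only [Function.comp_def, max_eq_left (h0 _)] using hc.measurable.comp hs

theorem integrable_mul_hPhiDerivRef {M : Type*} [TopologicalSpace M] [MeasurableSpace M]
    [BorelSpace M] {ω₀ : Measure M} {φ : ℝ → ℝ} (hφ : IsAdmissibleWeight φ) {Ψ : M → ℝ}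
    (hΨ : Continuous Ψ) (hprob : IsProbabilityMeasure (refMeasure ω₀ φ Ψ))
    (hdom : ∀ x, -upperLim φ < (Ψ x : EReal))
    (hln : Integrable
      (fun x => (refDensity φ Ψ x).toReal * lnPhi φ (refDensity φ Ψ x).toReal) ω₀) :
    Integrable (fun x => (refDensity φ Ψ x).toReal * hPhiDerivRef φ Ψ x) ω₀ := by
  refine (hln.sub ((integrable_toReal_refDensity hφ hΨ hprob).1.mul_const (upperShift φ))).congr ?_
  exact ae_of_all _ fun x => (hPhiDerivRef_mul_refDensity hφ (hdom x)).symm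

/-- The reference measure minimizes the relative entropy. -/
theorem refEnergy_le_relEntropy {M : Type*} [TopologicalSpace M] [MeasurableSpace M]
    [BorelSpace M] {ω₀ : Measure M} [SigmaFinite ω₀] {φ : ℝ → ℝ} (hφ : IsAdmissibleWeight φ)
    (hθ : theta φ < ⊤) (h1 : φ 1 = 1) (hp : maxOrder φ < 3 / 2) {Ψ : M → ℝ}
    (hΨ : Continuous Ψ) (hprob : IsProbabilityMeasure (refMeasure ω₀ φ Ψ))
    (hdom : ∀ x, -upperLim φ < (Ψ x : EReal))
    (hh : Integrable (fun x => hPhi φ (refDensity φ Ψ x).toReal) ω₀)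
    (hln : Integrable
      (fun x => (refDensity φ Ψ x).toReal * lnPhi φ (refDensity φ Ψ x).toReal) ω₀)
    (μ : Measure M) [IsFiniteMeasure μ] :
    (refEnergy ω₀ φ Ψ : EReal) ≤ relEntropy ω₀ φ Ψ μ := by
  unfold relEntropy
  split_ifs with hint
  swap
  · exact le_top
  obtain ⟨hI, hJ⟩ := hint
  have hρm := Measure.measurable_rnDeriv μ ω₀
  have hρt := Measure.rnDeriv_lt_top μ ω₀
  have hJ1 : Integrable (hPhiDerivRef φ Ψ) (ω₀.withDensity (μ.rnDeriv ω₀)) :=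
    hJ.mono_measure (Measure.withDensity_rnDeriv_le _ _)
  have hJ2 : Integrable (hPhiDerivRef φ Ψ) (μ.singularPart ω₀) :=
    hJ.mono_measure (Measure.singularPart_le _ _)
  have hsplit : ∫ x, hPhiDerivRef φ Ψ x ∂μ =
      ∫ x, (μ.rnDeriv ω₀ x).toReal * hPhiDerivRef φ Ψ x ∂ω₀ +
        ∫ x, hPhiDerivRef φ Ψ x ∂(μ.singularPart ω₀) := by
    conv_lhs => rw [← Measure.rnDeriv_add_singularPart μ ω₀]
    rw [integral_add_measure hJ1 hJ2, integral_withDensity_eq_integral_toReal_smul hρm hρt]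
    simp [smul_eq_mul]
  have hJ3 : Integrable (fun x => (μ.rnDeriv ω₀ x).toReal * hPhiDerivRef φ Ψ x) ω₀ :=
    (integrable_withDensity_iff_integrable_smul' hρm hρt).1 hJ1
  have hmain : refEnergy ω₀ φ Ψ ≤ ∫ x, hPhi φ (μ.rnDeriv ω₀ x).toReal ∂ω₀ -
      ∫ x, (μ.rnDeriv ω₀ x).toReal * hPhiDerivRef φ Ψ x ∂ω₀ := by
    rw [← integral_sub hI hJ3]
    exact integral_mono (hh.sub (integrable_mul_hPhiDerivRef hφ hΨ hprob hdom hln)) (hI.sub hJ3)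
      fun x => entropyDensity_ge hφ hθ h1 hp (hdom x) ENNReal.toReal_nonneg
  rw [hsplit]
  by_cases hL : upperLim φ = ⊤
  · rw [hPhiDerivAtTop, if_pos hL]
    by_cases hs : μ.singularPart ω₀ univ = 0
    · rw [hs, Measure.measure_univ_eq_zero.1 hs]
      simp only [integral_zero_measure, add_zero, EReal.coe_ennreal_zero, mul_zero]
      exact_mod_cast hmain
    -- With `L_φ = ∞` any singular mass costs infinite entropy; with `L_φ < ∞` it contributes
    -- `-h'_φ(σ) ≥ 0`.
    · rw [EReal.top_mul_of_pos (by simpa [pos_iff_ne_zero] using hs), EReal.coe_add_top]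
      exact le_top
  · rw [hPhiDerivAtTop, if_neg hL, zero_mul, add_zero, EReal.coe_le_coe_iff]
    have : ∫ x, hPhiDerivRef φ Ψ x ∂(μ.singularPart ω₀) ≤ 0 :=
      integral_nonpos fun x => hPhiDerivRef_nonpos hφ (hdom x) hL
    linarith

theorem cond_refMeasure_eq_withDensity {M : Type*} [TopologicalSpace M] [MeasurableSpace M]
    [BorelSpace M] {ω₀ : Measure M} {φ : ℝ → ℝ} (hφ : IsAdmissibleWeight φ) {Ψ : M → ℝ}
    (hΨ : Continuous Ψ) {S : Set M} (hS : MeasurableSet S) :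
    ProbabilityTheory.cond (refMeasure ω₀ φ Ψ) S =
      ω₀.withDensity (S.indicator fun x => (refMeasure ω₀ φ Ψ S)⁻¹ * refDensity φ Ψ x) := by
  rw [ProbabilityTheory.cond, withDensity_indicator hS]
  conv_lhs => rw [refMeasure, restrict_withDensity hS, ← refMeasure]
  exact (withDensity_smul _ (measurable_refDensity hφ hΨ)).symm

/-- Entropy of the reference measure conditioned on a set. -/
theorem relEntropy_cond_le {M : Type*} [TopologicalSpace M] [MeasurableSpace M]
    [BorelSpace M] {ω₀ : Measure M} [SigmaFinite ω₀] {φ : ℝ → ℝ} (hφ : IsAdmissibleWeight φ)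
    (hθ : theta φ < ⊤) (h1 : φ 1 = 1) (hp : maxOrder φ < 3 / 2) {Ψ : M → ℝ}
    (hΨ : Continuous Ψ) (hprob : IsProbabilityMeasure (refMeasure ω₀ φ Ψ))
    (hdom : ∀ x, -upperLim φ < (Ψ x : EReal))
    (hh : Integrable (fun x => hPhi φ (refDensity φ Ψ x).toReal) ω₀)
    (hln : Integrable
      (fun x => (refDensity φ Ψ x).toReal * lnPhi φ (refDensity φ Ψ x).toReal) ω₀)
    (hfin : 1 < maxOrder φ → ω₀ univ < ⊤) {ξ : ℝ} (hξ : 1 ≤ ξ)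
    (hσ : ∀ᵐ x ∂ω₀, (refDensity φ Ψ x).toReal ≤ ξ)
    {S : Set M} (hS : MeasurableSet S) {η : ℝ≥0∞} (hη : η ≠ 0) (hηS : η ≤ refMeasure ω₀ φ Ψ S) :
    relEntropy ω₀ φ Ψ (ProbabilityTheory.cond (refMeasure ω₀ φ Ψ) S) ≤
      ((refEnergy ω₀ φ Ψ + ((η⁻¹).toReal ^ 2 + 2 / (3 / 2 - maxOrder φ)) *
        (ξ ^ (maxOrder φ - (delta φ).toReal) * (1 + ω₀.real univ)) : ℝ) : EReal) := by
  set m := refMeasure ω₀ φ Ψ S with hmdef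
  set σ : M → ℝ := fun x => (refDensity φ Ψ x).toReal with hσdef
  set d : M → ℝ≥0∞ := S.indicator fun x => m⁻¹ * refDensity φ Ψ x with hd
  set c : ℝ := (m⁻¹).toReal with hc
  set D := ξ ^ (maxOrder φ - (delta φ).toReal) with hD
  have hp1 : 1 ≤ maxOrder φ := le_max_left _ _
  have hD0 : 0 ≤ D := Real.rpow_nonneg (by linarith) _
  have hC0 : 0 ≤ 2 / (3 / 2 - maxOrder φ) := div_nonneg zero_le_two (by linarith)
  have hm0 : m ≠ 0 := (pos_iff_ne_zero.2 hη |>.trans_le hηS).ne'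
  have hm1 : m ≤ 1 := prob_le_one
  have hc1 : 1 ≤ c := by
    have : (1 : ℝ≥0∞) ≤ m⁻¹ := ENNReal.one_le_inv.2 hm1
    rw [← ENNReal.toReal_one]
    exact ENNReal.toReal_mono (ENNReal.inv_ne_top.2 hm0) this
  have hcη : c ≤ (η⁻¹).toReal :=
    ENNReal.toReal_mono (ENNReal.inv_ne_top.2 hη) (ENNReal.inv_le_inv.2 hηS)
  have hrm := measurable_refDensity hφ hΨ
  have hdm : Measurable d := (hrm.const_mul _).indicator hS
  have hdS : ∀ x ∈ S, (d x).toReal = c * σ x := fun x hx => by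
    simp [hd, hx, hc, hσdef, ENNReal.toReal_mul]
  have hdS' : ∀ x ∉ S, (d x).toReal = 0 := fun x hx => by simp [hd, hx]
  have hdtop : ∀ x, d x < ⊤ := fun x => by
    by_cases hx : x ∈ S
    · simp only [hd, indicator_of_mem hx]
      exact ENNReal.mul_lt_top (lt_top_iff_ne_top.2 (ENNReal.inv_ne_top.2 hm0))
        (lt_top_iff_ne_top.2 (refDensity_cases hφ (hdom x)).1)
    · simp [hd, hx]
  obtain ⟨hσi, hσ1⟩ := integrable_toReal_refDensity hφ hΨ hprob
  obtain ⟨hqi, hqle⟩ := integrable_rpow_and_integral_le (q := 2 - maxOrder φ)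
    (fun x => ENNReal.toReal_nonneg) hσi hσ1 (by linarith) (by linarith)
    (fun h => hfin (by linarith))
  have hσg : Integrable (fun x => σ x * hPhiDerivRef φ Ψ x) ω₀ :=
    integrable_mul_hPhiDerivRef hφ hΨ hprob hdom hln
  have hdg : Integrable (fun x => (d x).toReal * hPhiDerivRef φ Ψ x) ω₀ := by
    refine ((hσg.const_mul c).indicator hS).congr (ae_of_all _ fun x => ?_)
    by_cases hx : x ∈ S
    · simp only [indicator_of_mem hx, hdS x hx]; ring
    · simp [hx, hdS' x hx]
  have he : Integrable (fun x => hPhi φ (σ x) - σ x * hPhiDerivRef φ Ψ x) ω₀ := hh.sub hσg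
  set B := (η⁻¹).toReal ^ 2 + 2 / (3 / 2 - maxOrder φ) with hB
  have hup : Integrable (fun x => hPhi φ (σ x) - σ x * hPhiDerivRef φ Ψ x +
      B * (D * σ x ^ (2 - maxOrder φ))) ω₀ := he.add ((hqi.const_mul D).const_mul B)
  have hlow : ∀ x, hPhi φ (σ x) - σ x * hPhiDerivRef φ Ψ x ≤
      hPhi φ (d x).toReal - (d x).toReal * hPhiDerivRef φ Ψ x := fun x =>
    entropyDensity_ge hφ hθ h1 hp (hdom x) ENNReal.toReal_nonneg
  have hhigh : ∀ᵐ x ∂ω₀, hPhi φ (d x).toReal - (d x).toReal * hPhiDerivRef φ Ψ x ≤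
      hPhi φ (σ x) - σ x * hPhiDerivRef φ Ψ x + B * (D * σ x ^ (2 - maxOrder φ)) := by
    filter_upwards [hσ] with x hx
    have hX : 0 ≤ D * σ x ^ (2 - maxOrder φ) :=
      mul_nonneg hD0 (Real.rpow_nonneg ENNReal.toReal_nonneg _)
    by_cases hxS : x ∈ S
    · rw [hdS x hxS]
      refine (entropyDensity_mul_le hφ hθ h1 hp (hdom x) hξ hx hc1).trans ?_
      have : c ^ 2 ≤ B := by
        have : c ^ 2 ≤ (η⁻¹).toReal ^ 2 := by gcongr
        linarith
      gcongr
    · rw [hdS' x hxS, zero_mul, sub_zero, hPhi_eq φ 0, uPhi_zero, zero_mul, sub_zero]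
      refine (entropyDensity_zero_le hφ hθ h1 hp (hdom x) hξ hx).trans ?_
      have : 2 / (3 / 2 - maxOrder φ) ≤ B := by
        have := sq_nonneg (η⁻¹).toReal
        linarith
      gcongr
  have hmeas : AEStronglyMeasurable
      (fun x => hPhi φ (d x).toReal - (d x).toReal * hPhiDerivRef φ Ψ x) ω₀ :=
    (measurable_hPhi_comp hφ hθ h1 hp hdm.ennreal_toReal
      fun x => ENNReal.toReal_nonneg).aestronglyMeasurable.sub hdg.aestronglyMeasurable
  have hF : Integrable
      (fun x => hPhi φ (d x).toReal - (d x).toReal * hPhiDerivRef φ Ψ x) ω₀ :=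
    -- Integrability is not known in advance: the density is squeezed between the reference density
    -- of energy and its perturbation, and `h_φ(d)` is then recovered by adding back the linear
    -- term.
    integrable_of_le_of_le hmeas (ae_of_all _ hlow) hhigh he hup
  have hhd : Integrable (fun x => hPhi φ (d x).toReal) ω₀ :=
    (hF.add hdg).congr (ae_of_all _ fun x => by simp)
  have hle : ∫ x, hPhi φ (d x).toReal ∂ω₀ - ∫ x, (d x).toReal * hPhiDerivRef φ Ψ x ∂ω₀ ≤
      refEnergy ω₀ φ Ψ + B * (D * (1 + ω₀.real univ)) := by
    rw [← integral_sub hhd hdg]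
    refine (integral_mono_ae hF hup hhigh).trans ?_
    rw [integral_add he ((hqi.const_mul D).const_mul B), integral_const_mul, integral_const_mul]
    change refEnergy ω₀ φ Ψ + _ ≤ _
    have : 0 ≤ B := by positivity
    gcongr
  rw [cond_refMeasure_eq_withDensity hφ hΨ hS]
  change relEntropy ω₀ φ Ψ (ω₀.withDensity d) ≤ _
  have hrn : (fun x => hPhi φ ((ω₀.withDensity d).rnDeriv ω₀ x).toReal) =ᵐ[ω₀]
      fun x => hPhi φ (d x).toReal := by
    filter_upwards [Measure.rnDeriv_withDensity ω₀ hdm] with x hx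
    rw [hx]
  have hgi : Integrable (hPhiDerivRef φ Ψ) (ω₀.withDensity d) :=
    (integrable_withDensity_iff_integrable_smul' hdm (ae_of_all _ hdtop)).2 hdg
  rw [relEntropy, if_pos ⟨hhd.congr hrn.symm, hgi⟩, Measure.singularPart_withDensity,
    integral_congr_ae hrn,
    integral_withDensity_eq_integral_toReal_smul hdm (ae_of_all _ hdtop)]
  simp only [Measure.coe_zero, Pi.zero_apply, EReal.coe_ennreal_zero, mul_zero, add_zero,
    smul_eq_mul]
  exact_mod_cast hle

/-! ### Wasserstein distance and concentration -/

/-- Every coupling is carried by pairs in `A × B`, so its cost is at least `r²`. The bound `R`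
serves only for finiteness, as the conversion to a real number would send an infinite cost to `0`.
-/
theorem le_wassersteinDist {M : Type*} [MetricSpace M] [MeasurableSpace M] (μ ν : ProbTwo M)
    {A B : Set M} {r R : ℝ} (hμ : ∀ᵐ x ∂μ.1, x ∈ A) (hν : ∀ᵐ x ∂ν.1, x ∈ B)
    (hr : ∀ x ∈ A, ∀ y ∈ B, r ≤ dist x y) (hR : ∀ x ∈ A, ∀ y ∈ B, dist x y ≤ R) :
    r ≤ wassersteinDist μ ν := by
  have := μ.2.1
  have := ν.2.1
  have hq : ∀ q, IsCoupling q μ.1 ν.1 → ∀ᵐ z ∂q, z.1 ∈ A ∧ z.2 ∈ B := fun q hq => by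
    rw [← hq.1] at hμ
    rw [← hq.2] at hν
    exact (ae_of_ae_map measurable_fst.aemeasurable hμ).and
      (ae_of_ae_map measurable_snd.aemeasurable hν)
  have hq1 : ∀ q, IsCoupling q μ.1 ν.1 → q univ = 1 := fun q hq => by
    rw [← μ.2.1.measure_univ, ← hq.1, Measure.map_apply measurable_fst MeasurableSet.univ,
      preimage_univ]
  set I := ⨅ (q : Measure (M × M)) (_ : IsCoupling q μ.1 ν.1),
    ∫⁻ z, edist z.1 z.2 ^ 2 ∂q with hI
  have hlow : ENNReal.ofReal r ^ 2 ≤ I := by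
    refine le_iInf₂ fun q hc => ?_
    calc ENNReal.ofReal r ^ 2 = ∫⁻ _, ENNReal.ofReal r ^ 2 ∂q := by
          rw [lintegral_const, hq1 q hc, mul_one]
      _ ≤ _ := lintegral_mono_ae <| (hq q hc).mono fun z hz => by
          rw [edist_dist]
          exact pow_le_pow_left' (ENNReal.ofReal_le_ofReal (hr _ hz.1 _ hz.2)) 2
  have hup : I ≤ ENNReal.ofReal R ^ 2 := by
    have hc : IsCoupling (μ.1.prod ν.1) μ.1 ν.1 := by
      constructor <;> simp
    refine iInf_le_of_le (μ.1.prod ν.1) (iInf_le_of_le hc ?_)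
    calc _ ≤ ∫⁻ _, ENNReal.ofReal R ^ 2 ∂(μ.1.prod ν.1) :=
          lintegral_mono_ae <| (hq _ hc).mono fun z hz => by
            rw [edist_dist]
            exact pow_le_pow_left' (ENNReal.ofReal_le_ofReal (hR _ hz.1 _ hz.2)) 2
      _ = _ := by rw [lintegral_const, hq1 _ hc, mul_one]
  have hItop : I ^ (1 / 2 : ℝ) ≠ ⊤ :=
    ENNReal.rpow_ne_top_of_nonneg (by norm_num)
      (ne_top_of_le_ne_top (ENNReal.pow_ne_top ENNReal.ofReal_ne_top) hup)
  refine (ENNReal.ofReal_le_iff_le_toReal hItop).1 ?_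
  have h := ENNReal.rpow_le_rpow hlow (by norm_num : (0 : ℝ) ≤ 1 / 2)
  rwa [← ENNReal.rpow_natCast, ← ENNReal.rpow_mul,
    show ((2 : ℕ) : ℝ) * (1 / 2) = 1 by norm_num, ENNReal.rpow_one] at h

/-- A `K`-convex function bounded below cannot be small at two distant points. -/
theorem IsKConvex.mul_sq_le {X : Type*} {d : X → X → ℝ} {K : ℝ} {F : X → EReal}
    (hF : IsKConvex d K F) {E c : ℝ} (hE : ∀ z, (E : EReal) ≤ F z) {x y : X}
    (hx : F x ≤ ((E + c : ℝ) : EReal)) (hy : F y ≤ ((E + c : ℝ) : EReal)) :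
    K * d x y ^ 2 ≤ 8 * c := by
  obtain ⟨γ, -, hγ⟩ := hF.2 x y
  -- At the midpoint the convexity defect is `K d²/8`, which is the source of the factor `8`.
  have h := hγ ⟨1 / 2, by norm_num, by norm_num⟩
  have hlow := (hE _).trans h
  have lift : ∀ z, F z ≤ ((E + c : ℝ) : EReal) → ∃ a : ℝ, F z = a ∧ a ≤ E + c := fun z hz => by
    have h1 : F z ≠ ⊤ := (hz.trans_lt (EReal.coe_lt_top _)).ne
    have h2 : F z ≠ ⊥ := ne_bot_of_le_ne_bot (EReal.coe_ne_bot _) (hE z)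
    refine ⟨(F z).toReal, (EReal.coe_toReal h1 h2).symm, ?_⟩
    rw [← EReal.coe_toReal h1 h2] at hz
    exact_mod_cast hz
  obtain ⟨a, ha, hac⟩ := lift x hx
  obtain ⟨b, hb, hbc⟩ := lift y hy
  rw [ha, hb, ← EReal.coe_mul, ← EReal.coe_mul, ← EReal.coe_add, ← EReal.coe_sub,
    EReal.coe_le_coe_iff] at hlow
  norm_num at hlow
  linarith

theorem exists_lt_measure_inter_ball {M : Type*} [MetricSpace M] [MeasurableSpace M]
    (ν : Measure M) (S : Set M) (x₀ : M) {a : ℝ≥0∞} (h : a < ν S) :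
    ∃ R : ℝ, a < ν (S ∩ Metric.ball x₀ R) := by
  have hmono : Monotone fun k : ℕ => S ∩ Metric.ball x₀ k := fun i j hij =>
    inter_subset_inter_right _ (Metric.ball_subset_ball (by exact_mod_cast hij))
  have hU : ⋃ k : ℕ, S ∩ Metric.ball x₀ k = S := by
    rw [← inter_iUnion, Metric.iUnion_ball_nat, inter_univ]
  rw [← hU, hmono.measure_iUnion] at h
  obtain ⟨k, hk⟩ := lt_iSup_iff.1 h
  exact ⟨k, hk⟩

/-- A probability measure conditioned on a bounded set of positive measure. -/
def condProbTwo {M : Type*} [MetricSpace M] [MeasurableSpace M] (ν : Measure M)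
    [IsFiniteMeasure ν] {S : Set M} (hS : MeasurableSet S) (h0 : ν S ≠ 0) {x₀ : M} {R : ℝ}
    (hSR : S ⊆ Metric.ball x₀ R) : ProbTwo M :=
  ⟨ProbabilityTheory.cond ν S, ProbabilityTheory.cond_isProbabilityMeasure h0, x₀, by
    have := ProbabilityTheory.cond_isProbabilityMeasure (μ := ν) h0
    calc ∫⁻ x, edist x₀ x ^ 2 ∂(ProbabilityTheory.cond ν S)
        ≤ ∫⁻ _, ENNReal.ofReal R ^ 2 ∂(ProbabilityTheory.cond ν S) := by
          refine lintegral_mono_ae ((ProbabilityTheory.ae_cond_mem hS).mono fun x hx => ?_)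
          rw [edist_dist, dist_comm]
          exact pow_le_pow_left' (ENNReal.ofReal_le_ofReal (hSR hx).le) 2
      _ < ⊤ := by
        rw [lintegral_const, measure_univ, mul_one]
        exact ENNReal.pow_lt_top ENNReal.ofReal_lt_top⟩

/-- Either the concentration function is small or the convexity modulus is controlled. -/
theorem concentration_le_or {M : Type*} [MetricSpace M] [Nonempty M] [MeasurableSpace M]
    [BorelSpace M] {ω₀ : Measure M} [SigmaFinite ω₀] {φ : ℝ → ℝ} (hφ : IsAdmissibleWeight φ)
    (hθ : theta φ < ⊤) (h1 : φ 1 = 1) (hp : maxOrder φ < 3 / 2) {Ψ : M → ℝ}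
    (hΨ : Continuous Ψ) (hprob : IsProbabilityMeasure (refMeasure ω₀ φ Ψ))
    (hdom : ∀ x, -upperLim φ < (Ψ x : EReal))
    (hh : Integrable (fun x => hPhi φ (refDensity φ Ψ x).toReal) ω₀)
    (hln : Integrable
      (fun x => (refDensity φ Ψ x).toReal * lnPhi φ (refDensity φ Ψ x).toReal) ω₀)
    (hfin : 1 < maxOrder φ → ω₀ univ < ⊤) {ξ : ℝ} (hξ : 1 ≤ ξ)
    (hσ : ∀ᵐ x ∂ω₀, (refDensity φ Ψ x).toReal ≤ ξ) {K : ℝ} (hK : 0 ≤ K)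
    (hconv : IsKConvex (X := ProbTwo M) wassersteinDist K (fun μ => relEntropy ω₀ φ Ψ μ.1))
    {r : ℝ} (hr : 0 ≤ r) {ε : ℝ≥0∞} (hε : ε ≠ 0) :
    concentration (refMeasure ω₀ φ Ψ) r ≤ ε ∨
      K * r ^ 2 ≤ 8 * (((((min (1 / 4) ε)⁻¹).toReal ^ 2 + 2 / (3 / 2 - maxOrder φ)) *
        (ξ ^ (maxOrder φ - (delta φ).toReal) * (1 + ω₀.real univ)))) := by
  refine or_iff_not_imp_left.2 fun hnot => ?_
  set ν := refMeasure ω₀ φ Ψ with hν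
  -- Any constant below `1/2` would do: the strict inequality leaves room to replace both sets by
  -- bounded parts, needed for finite second moments.
  set η : ℝ≥0∞ := min (1 / 4) ε with hηdef
  have hη : η ≠ 0 := by
    rw [hηdef, ← pos_iff_ne_zero, lt_min_iff]
    exact ⟨by simp, pos_iff_ne_zero.2 hε⟩
  obtain ⟨A, h⟩ := lt_iSup_iff.1 (not_le.1 hnot)
  obtain ⟨hA, h⟩ := lt_iSup_iff.1 h
  obtain ⟨hA2, h⟩ := lt_iSup_iff.1 h
  rw [← prob_compl_eq_one_sub Metric.isOpen_thickening.measurableSet] at h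
  have hB : MeasurableSet (Metric.thickening r A)ᶜ := Metric.isOpen_thickening.measurableSet.compl
  obtain ⟨x₀⟩ := ‹Nonempty M›
  have hAη : η < ν A := by
    refine (min_le_left _ _).trans_lt (lt_of_lt_of_le ?_ hA2)
    rw [one_div, one_div, ENNReal.inv_lt_inv]
    norm_num
  obtain ⟨R, hR⟩ := exists_lt_measure_inter_ball ν A x₀ hAη
  obtain ⟨R', hR'⟩ := exists_lt_measure_inter_ball ν _ x₀ ((min_le_right _ _).trans_lt h)
  have hAm := hA.inter (Metric.isOpen_ball (x := x₀) (ε := R)).measurableSet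
  have hBm := hB.inter (Metric.isOpen_ball (x := x₀) (ε := R')).measurableSet
  set μA := condProbTwo ν hAm (zero_le.trans_lt hR).ne' inter_subset_right
  set μB := condProbTwo ν hBm (zero_le.trans_lt hR').ne' inter_subset_right
  have hW : r ≤ wassersteinDist μA μB := by
    refine le_wassersteinDist μA μB (R := R + R') (ProbabilityTheory.ae_cond_mem hAm)
      (ProbabilityTheory.ae_cond_mem hBm) (fun x hx y hy => ?_) fun x hx y hy => ?_
    · by_contra! hlt
      exact hy.1 (Metric.mem_thickening_iff.2 ⟨x, hx.1, by rwa [dist_comm]⟩)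
    · have h2 : dist x x₀ < R := hx.2
      have h3 : dist y x₀ < R' := hy.2
      linarith [dist_triangle_right x y x₀]
  have hmain := hconv.mul_sq_le (E := refEnergy ω₀ φ Ψ) (x := μA) (y := μB)
    (fun z => by
      have := z.2.1
      exact refEnergy_le_relEntropy hφ hθ h1 hp hΨ hprob hdom hh hln z.1)
    (relEntropy_cond_le hφ hθ h1 hp hΨ hprob hdom hh hln hfin hξ hσ hAm hη hR.le)
    (relEntropy_cond_le hφ hθ h1 hp hΨ hprob hdom hh hln hfin hξ hσ hBm hη hR'.le)
  refine le_trans ?_ hmain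
  gcongr

end PhiEntropy

end

open PhiEntropy
theorem theorem7p6 {n : ℕ} (hn : 2 ≤ n) {M : Type*} [MetricSpace M] [CompleteSpace M]
    [ConnectedSpace M] [SecondCountableTopology M] [MeasurableSpace M] [BorelSpace M]
    [ChartedSpace (EuclideanSpace ℝ (Fin n)) M] [IsManifold (𝓡 n) ∞ M]
    [RiemannianBundle (fun x : M => TangentSpace (𝓡 n) x)]
    [IsContMDiffRiemannianBundle (𝓡 n) ∞ (EuclideanSpace ℝ (Fin n))
      (fun x : M => TangentSpace (𝓡 n) x)]
    [IsRiemannianManifold (𝓡 n) M]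
    (f : M → ℝ) (hf : ContMDiff (𝓡 n) 𝓘(ℝ, ℝ) ∞ f)
    (ω₀ : Measure M) (hbase : ω₀ = weightedVolume n f)
    (φ : ℝ → ℝ) (hφ : IsAdmissibleWeight φ)
    (Ψ : ℕ → M → ℝ) (hadm : ∀ i, IsAdmissible n ω₀ φ (Ψ i))
    (hfin : 1 < theta φ → ω₀ univ < ⊤)
    (hprob : ∀ i, IsProbabilityMeasure (refMeasure ω₀ φ (Ψ i)))
    (hbdd : ∀ i, essSup (refDensity φ (Ψ i)) ω₀ < ⊤)
    (K : ℕ → ℝ) (hK : ∀ i, 0 < K i)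
    (hconv : ∀ i, IsKConvex (X := ProbTwo M) wassersteinDist (K i)
      (fun μ => relEntropy ω₀ φ (Ψ i) μ.1))
    (hlim₁ : theta φ ≤ 1 → Tendsto
      (fun i => K i * densityBound ω₀ (refDensity φ (Ψ i)) ^ ((delta φ).toReal - 1)) atTop atTop)
    (hlim₂ : 1 < theta φ → Tendsto
      (fun i => K i * densityBound ω₀ (refDensity φ (Ψ i)) ^
        ((delta φ).toReal - (theta φ).toReal)) atTop atTop)
    (r : ℝ) (hr : 0 < r) :
    Tendsto (fun i => concentration (refMeasure ω₀ φ (Ψ i)) r) atTop (𝓝 0) := by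
  have hsig : SigmaFinite ω₀ := by
    have := sigmaFinite_riemannianVolume n M
    rw [hbase, weightedVolume]
    infer_instance
  have hθ : theta φ < ⊤ := (hadm 0).theta_lt.trans (EReal.coe_lt_top _)
  have hθc := coe_toReal_theta hφ hθ
  have h1 : φ 1 = 1 := (hadm 0).normalized
  have hp : maxOrder φ < 3 / 2 := by
    have h := (hadm 0).theta_lt
    rw [← hθc, EReal.coe_lt_coe_iff] at h
    exact max_lt (by norm_num) h
  have hfin' : 1 < maxOrder φ → ω₀ univ < ⊤ := fun h => hfin <| by
    rw [← hθc]
    exact_mod_cast (lt_max_iff.1 h).resolve_left (lt_irrefl _)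
  -- The two limit hypotheses are one statement once the exponent is written with `max {1, θ_φ}`.
  have hlim : Tendsto (fun i => K i * densityBound ω₀ (refDensity φ (Ψ i)) ^
      ((delta φ).toReal - maxOrder φ)) atTop atTop := by
    rcases le_or_gt (theta φ) 1 with h | h
    · have h' : (theta φ).toReal ≤ 1 := by
        rw [← hθc] at h
        exact_mod_cast h
      rw [maxOrder, max_eq_left h']
      exact hlim₁ h
    · have h' : 1 < (theta φ).toReal := by
        rw [← hθc] at h
        exact_mod_cast h
      rw [maxOrder, max_eq_right h'.le]
      exact hlim₂ h
  rw [ENNReal.tendsto_nhds_zero]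
  intro ε hε
  set B := ((min (1 / 4) ε)⁻¹).toReal ^ 2 + 2 / (3 / 2 - maxOrder φ) with hB
  filter_upwards [hlim.eventually_gt_atTop (8 * (B * (1 + ω₀.real univ)) / r ^ 2)] with i hi
  set ξ := densityBound ω₀ (refDensity φ (Ψ i)) with hξ
  have hξ1 : 1 ≤ ξ := le_max_left _ _
  have hσ : ∀ᵐ x ∂ω₀, (refDensity φ (Ψ i) x).toReal ≤ ξ := by
    filter_upwards [ENNReal.ae_le_essSup (μ := ω₀) (refDensity φ (Ψ i))] with x hx
    exact (ENNReal.toReal_mono (hbdd i).ne hx).trans (le_max_right _ _)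
  have hdom : ∀ x, -upperLim φ < (Ψ i x : EReal) := fun x =>
    (EReal.neg_le_neg_iff.2 (upperLim_powerWeight_le hφ hθ h1)).trans_lt
      ((hadm i).lt_potential x)
  refine (concentration_le_or hφ hθ h1 hp (hadm i).continuous (hprob i) hdom (hadm i).integrable_h
    (hadm i).integrable_mul_ln hfin' hξ1 hσ (hK i).le (hconv i) hr.le hε.ne').resolve_right ?_
  intro hle
  have hξ0 : 0 < ξ ^ ((delta φ).toReal - maxOrder φ) := Real.rpow_pos_of_pos (by linarith) _
  have hone : ξ ^ (maxOrder φ - (delta φ).toReal) * ξ ^ ((delta φ).toReal - maxOrder φ) = 1 := by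
    rw [← Real.rpow_add (by linarith)]; simp
  rw [div_lt_iff₀ (by positivity)] at hi
  -- Multiplying by `ξ^(δ-p)` removes the dependence of the right-hand side on the index,
  -- contradicting the choice of threshold.
  have h2 := mul_le_mul_of_nonneg_right hle hξ0.le
  rw [show 8 * (B * (ξ ^ (maxOrder φ - (delta φ).toReal) * (1 + ω₀.real univ))) *
    ξ ^ ((delta φ).toReal - maxOrder φ) = 8 * (B * (1 + ω₀.real univ)) *
    (ξ ^ (maxOrder φ - (delta φ).toReal) * ξ ^ ((delta φ).toReal - maxOrder φ)) by ring,
    hone, mul_one] at h2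
  linarith
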